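/- **Setting.** Let $T\ge 2$, $n\ge 1$, $M\ge 0$ be integers with $(t-1)\mid M$ for $2\le t\le T$, let $p>n+M$, $\sigma\ge 0$, and let $\bm w_1^*,\dots,\bm w_T^*\in\mathbb R^p$. At time $t\in[T]$ one has a current data set $(\bm X_{t,t},\bm Y_{t,t})$ with $n$ samples and, for each $h\in[t-1]$, a memory data set $(\bm X_{t,h},\bm Y_{t,h})$ with $M/(t-1)$ samples, where $\bm Y_{t,h}=\bm X_{t,h}^\top \bm w_h^*+\bm z_{t,h}$ for $h\in[t]$; all entries of all $\bm X_{t,h}$ are standard Gaussian, all entries of all $\bm z_{t,h}$ are $\mathcal N(0,\sigma^2)$, and all of them are jointly independent. For each $t\in[T]$ let $[t-1]$ be partitioned into fixed (non-random) sets $\mathcal I_t^{(\mathrm{sim})}$ and $\mathcal I_t^{(\mathrm{dis})}$, the latter listed in a fixed order; write $s_t=|\mathcal I_t^{(\mathrm{sim})}|$, $q_t=|\mathcal I_t^{(\mathrm{dis})}|$, let $f_t(j)\in\{1,\dots,q_t\}$ be the position of $j\in\mathcal I_t^{(\mathrm{dis})}$, and let $\mathbf 1^{(\mathrm{sim})}_{t,j}$,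 $\mathbf 1^{(\mathrm{dis})}_{t,j}$ be the indicators of $j\in \mathcal I_t^{(\mathrm{sim})}$, $j\in\mathcal I_t^{(\mathrm{dis})}$. Assume that $p-n-1\ne0$ and $p-n-\frac{M}{t-1}s_t-1\neq 0$ for $2\le t\le T$ (automatic if $p>n+M+1$). **Hybrid rehearsal.** $\bm w_0=\bm 0$. At time $t$, first $\hat{\bm w}_t^{(0)}=\arg\min_{\bm w}\|\bm w-\bm w_{t-1}\|^2$ subject to $\bm X_{t,h}^\top\bm w=\bm Y_{t,h}$ for all $h\in\{t\}\cup \mathcal I_t^{(\mathrm{sim})}$; then for $s=1,\dots,q_t$, with $h$ the $s$-th element of $\mathcal I_t^{(\mathrm{dis})}$, $\hat{\bm w}_t^{(s)}=\arg\min_{\bm w}\|\bm w-\hat{\bm w}_t^{(s-1)}\|^2$ subject to $\bm X_{t,h}^\top\bm w=\bm Y_{t,h}$; finally $\bm w_t=\hat{\bm w}_t^{(q_t)}$. Put $\mathcal L_i(\bm w)=\|\bm w-\bm w_i^*\|^2$, $F_T=\frac1{T-1}\sum_{i=1}^{T-1}\mathbb E[\mathcal L_i(\bm w_T)-\mathcal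 L_i(\bm w_i)]$ and $G_T=\frac1T\sum_{i=1}^T\mathbb E[\mathcal L_i(\bm w_T)]$. **Claim.** All $\mathcal L_i(\bm w_t)$, $i,t\in[T]$, are integrable, and $$F_T=\frac1{T-1}\Big[\sum_{i=1}^{T-1}c_i\|\bm w_i^*\|^2+\sum_{i=1}^{T-1}\sum_{j,k=1}^{T}c_{ijk}\|\bm w_j^*-\bm w_k^*\|^2+\sum_{i=1}^{T-1}\big(\mathrm{noise}_T(\sigma)-\mathrm{noise}_i(\sigma)\big)\Big],$$ $$G_T=\frac1T\Big[d_{0T}\sum_{i=1}^T\|\bm w_i^*\|^2+\sum_{i=1}^T\sum_{j,k=1}^Td_{ijkT}\|\bm w_j^*-\bm w_k^*\|^2\Big]+\mathrm{noise}_T(\sigma),$$ where, with $r_a=1-\frac{n+a}{p}$, $B_{l,t}=\frac{M}{(t-l-1)p}$ for $l\ne t-1$ and $B_{t-1,t}=0$, $K_{l,t}=\frac{B_{l,t}}{p-n-\frac{M}{t-l-1}s_{t-l}-1}$ for $l\neq t-1$ and $K_{t-1,t}=0$, $\Gamma_t(a)=\prod_{l=0}^{a-1}\big[(1-B_{l,t})^{q_{t-l}}\,r_{\frac{M}{t-l-1}s_{t-l}}\big]$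 and $\Lambda_{a,\sigma}=\frac{a\sigma^2}{p-a-1}$, $$d_{0t}=r_0\Gamma_t(t-1),\qquad c_i=d_{0T}-d_{0i},\qquad c_{ijk}=d_{ijkT}-d_{ijki},$$ and, for $i\le t$, the coefficient $d_{ijkt}$ is as follows. * If $k=i$ and $j\in[t-1]$: $$\begin{aligned}d_{ijkt}={}&\sum_{l=0}^{t-j-1}(1-B_{l,t})^{q_{t-l}}\Gamma_t(l)B_{l,t}\mathbf 1^{(\mathrm{sim})}_{t-l,j}+\sum_{l=0}^{t-2}(1-B_{l,t})^{q_{t-l}}\Gamma_t(l)\,pB_{l,t}K_{l,t}\mathbf 1^{(\mathrm{sim})}_{t-l,j}\mathbf 1^{(\mathrm{sim})}_{t-l,k}\\&+(1-B_{t-k,t})^{q_k}n\Gamma_t(t-k)K_{t-k,t}\mathbf 1^{(\mathrm{sim})}_{k,j}+(1-B_{t-j,t})^{q_j}n\Gamma_t(t-j)K_{t-j,t}\mathbf 1^{(\mathrm{sim})}_{j,k}\\&+(1-B_{t-j,t})^{q_j}\Gamma_t(t-j)(1-r_0)+\sum_{l=0}^{t-j-1}\Gamma_t(l)(1-B_{l,t})^{q_{t-l}-f_{t-l}(j)}B_{l,t}\mathbf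 1^{(\mathrm{dis})}_{t-l,j}\end{aligned}$$ (a term with $\mathbf 1^{(\mathrm{dis})}_{t-l,j}=0$ is $0$). * If $k=i$ and $j=t$: $d_{ijkt}=(1-B_{0,t})^{q_t}\big[(1-r_0)+nK_{0,t}\mathbf 1^{(\mathrm{sim})}_{t,i}\big]$. * If $j<k<t$ and $j,k\ne i$: $d_{ijkt}=\sum_{l=0}^{t-2}(1-B_{l,t})^{q_{t-l}}\Gamma_t(l)\,pB_{l,t}K_{l,t}\mathbf 1^{(\mathrm{sim})}_{t-l,j}\mathbf 1^{(\mathrm{sim})}_{t-l,k}+(1-B_{t-k,t})^{q_k}n\Gamma_t(t-k)K_{t-k,t}\mathbf 1^{(\mathrm{sim})}_{k,j}$. * If $j<k=t$ and $j,k\ne i$: $d_{ijkt}=(1-B_{0,t})^{q_t}nK_{0,t}\mathbf 1^{(\mathrm{sim})}_{t,j}$. * In all other cases $d_{ijkt}=0$. The noise term is $$\mathrm{noise}_t(\sigma)=\sum_{l=0}^{t-2}\Gamma_t(l)\Big(\sum_{j\in\mathcal I_{t-l}^{(\mathrm{dis})}}(1-B_{l,t})^{q_{t-l}-f_{t-l}(j)}\Lambda_{\frac{M}{t-l-1},\sigma}+(1-B_{l,t})^{q_{t-l}}\Lambda_{n+ps_{t-l}B_{l,t},\sigma}\Big)+\Gamma_t(t-1)\Lambda_{n,\sigma}.$$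 -/

import Mathlib

open scoped NNReal

/-! ## Training procedure -/

/-- Number of samples in the data set of source task `h` that is available at time `t`: the current
data set (`h = t`) has `n` samples, a memory data set (`h < t`) has `M / (t - 1)` samples. -/
def sampleCount (n M t h : ℕ) : ℕ := if h = t then n else M / (t - 1)

/-- Indices `(t, h, a)` of all samples used up to time `T`: at time `t ∈ [T]`, sample number `a` of
the data set of source task `h ∈ [t]`. -/
abbrev SampleIndex (T n M : ℕ) : Type :=
  {s : ℕ × ℕ × ℕ // 1 ≤ s.1 ∧ s.1 ≤ T ∧ 1 ≤ s.2.1 ∧ s.2.1 ≤ s.1 ∧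
    s.2.2 < sampleCount n M s.1 s.2.1}

open Classical in
/-- `argmin_{w ∈ C} ‖w - w₀‖²` (the starting point `w₀` itself if there is no minimizer). -/
noncomputable def nearestPoint {p : ℕ} (w₀ : EuclideanSpace ℝ (Fin p))
    (C : Set (EuclideanSpace ℝ (Fin p))) : EuclideanSpace ℝ (Fin p) :=
  if h : ∃ w ∈ C, IsMinOn (fun v => ‖v - w₀‖ ^ 2) C w then h.choose else w₀

/-- Parameters that fit all samples of the data set of source task `h` at time `t`, where sample `a`
has feature vector `X t h a` and output `Y t h a`; for `h = t` this is the current data set, for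
`h < t` it is the memory data set of task `h`. -/
def interpolants {p : ℕ} (n M : ℕ) (X : ℕ → ℕ → ℕ → EuclideanSpace ℝ (Fin p))
    (Y : ℕ → ℕ → ℕ → ℝ) (t h : ℕ) : Set (EuclideanSpace ℝ (Fin p)) :=
  {w | ∀ a < sampleCount n M t h, inner ℝ (X t h a) w = Y t h a}

/-- Hybrid rehearsal at time `t`, started at `w`: train concurrently on the current data and the
memory of all tasks in `sim t`, then train on the memory of the tasks in the list `dis t`, one after
the other in the order of the list. -/
noncomputable def hybridTask {p : ℕ} (n M : ℕ) (sim : ℕ → Finset ℕ) (dis : ℕ → List ℕ)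
    (X : ℕ → ℕ → ℕ → EuclideanSpace ℝ (Fin p)) (Y : ℕ → ℕ → ℕ → ℝ) (t : ℕ)
    (w : EuclideanSpace ℝ (Fin p)) : EuclideanSpace ℝ (Fin p) :=
  (dis t).foldl (fun v h => nearestPoint v (interpolants n M X Y t h))
    (nearestPoint w (interpolants n M X Y t t ∩ ⋂ h ∈ sim t, interpolants n M X Y t h))

/-- The parameters `w_t` after task `t`, with `w_0 = 0`. -/
noncomputable def hybridWeights {p : ℕ} (n M : ℕ) (sim : ℕ → Finset ℕ) (dis : ℕ → List ℕ)
    (X : ℕ → ℕ → ℕ → EuclideanSpace ℝ (Fin p)) (Y : ℕ → ℕ → ℕ → ℝ) :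
    ℕ → EuclideanSpace ℝ (Fin p)
  | 0 => 0
  | t + 1 => hybridTask n M sim dis X Y (t + 1) (hybridWeights n M sim dis X Y t)

/-! ## Data model -/

/-- All coordinates of all feature vectors are standard Gaussian, all noise variables are
`N(0, σ²)`, and all of them are jointly independent. -/
structure GaussianData {Ω : Type*} [MeasurableSpace Ω] (μ : MeasureTheory.Measure Ω)
    {p : ℕ} (T n M : ℕ) (σ : ℝ≥0) (x : ℕ → ℕ → ℕ → Ω → EuclideanSpace ℝ (Fin p))
    (z : ℕ → ℕ → ℕ → Ω → ℝ) : Prop where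
  feature_law : ∀ (s : SampleIndex T n M) (c : Fin p),
    ProbabilityTheory.HasLaw (fun ω => x s.1.1 s.1.2.1 s.1.2.2 ω c)
      (ProbabilityTheory.gaussianReal 0 1) μ
  noise_law : ∀ s : SampleIndex T n M,
    ProbabilityTheory.HasLaw (z s.1.1 s.1.2.1 s.1.2.2)
      (ProbabilityTheory.gaussianReal 0 (σ ^ 2)) μ
  indep : ProbabilityTheory.iIndepFun
    (Sum.elim
      (fun (q : SampleIndex T n M × Fin p) (ω : Ω) => x q.1.1.1 q.1.1.2.1 q.1.1.2.2 ω q.2)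
      (fun (s : SampleIndex T n M) (ω : Ω) => z s.1.1 s.1.2.1 s.1.2.2 ω)) μ

/-- Linear ground truth: `y = xᵀ w*_h + z` for every sample of source task `h`. -/
noncomputable def groundTruthOutput {Ω : Type*} {p : ℕ} (wstar : ℕ → EuclideanSpace ℝ (Fin p))
    (x : ℕ → ℕ → ℕ → Ω → EuclideanSpace ℝ (Fin p)) (z : ℕ → ℕ → ℕ → Ω → ℝ)
    (t h a : ℕ) (ω : Ω) : ℝ :=
  inner ℝ (x t h a ω) (wstar h) + z t h a ω

/-- The random parameters `w_t` obtained by hybrid rehearsal from the random data. -/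
noncomputable def randomHybridWeights {Ω : Type*} {p : ℕ} (n M : ℕ) (sim : ℕ → Finset ℕ)
    (dis : ℕ → List ℕ) (wstar : ℕ → EuclideanSpace ℝ (Fin p))
    (x : ℕ → ℕ → ℕ → Ω → EuclideanSpace ℝ (Fin p)) (z : ℕ → ℕ → ℕ → Ω → ℝ)
    (t : ℕ) (ω : Ω) : EuclideanSpace ℝ (Fin p) :=
  hybridWeights n M sim dis (fun t h a => x t h a ω)
    (fun t h a => groundTruthOutput wstar x z t h a ω) t

/-! ## Performance metrics -/

/-- Model error `ℒ_i(w) = ‖w - w*_i‖²`. -/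
noncomputable def modelError {p : ℕ} (wstar : ℕ → EuclideanSpace ℝ (Fin p)) (i : ℕ)
    (w : EuclideanSpace ℝ (Fin p)) : ℝ :=
  ‖w - wstar i‖ ^ 2

/-- Forgetting `F_T`. -/
noncomputable def forgetting {Ω : Type*} [MeasurableSpace Ω] (μ : MeasureTheory.Measure Ω)
    {p : ℕ} (T : ℕ) (wstar : ℕ → EuclideanSpace ℝ (Fin p))
    (w : ℕ → Ω → EuclideanSpace ℝ (Fin p)) : ℝ :=
  1 / ((T : ℝ) - 1) * ∑ i ∈ Finset.Icc 1 (T - 1),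
    ∫ ω, (modelError wstar i (w T ω) - modelError wstar i (w i ω)) ∂μ

/-- Generalization error `G_T`. -/
noncomputable def generalizationError {Ω : Type*} [MeasurableSpace Ω]
    (μ : MeasureTheory.Measure Ω) {p : ℕ} (T : ℕ) (wstar : ℕ → EuclideanSpace ℝ (Fin p))
    (w : ℕ → Ω → EuclideanSpace ℝ (Fin p)) : ℝ :=
  1 / (T : ℝ) * ∑ i ∈ Finset.Icc 1 T, ∫ ω, modelError wstar i (w T ω) ∂μ

/-! ## Coefficients -/

/-- `r_a = 1 - (n + a) / p`. -/
noncomputable def coeffR (p n : ℕ) (a : ℝ) : ℝ := 1 - ((n : ℝ) + a) / (p : ℝ)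

/-- `M / (t - l - 1)`, the size of each memory data set at time `t - l`. -/
noncomputable def memShare (M l t : ℕ) : ℝ := (M : ℝ) / ((t : ℝ) - (l : ℝ) - 1)

/-- `B_{l,t}`. -/
noncomputable def coeffB (p M l t : ℕ) : ℝ :=
  if l ≠ t - 1 then memShare M l t / (p : ℝ) else 0

/-- `K_{l,t}`. -/
noncomputable def coeffK (p n M : ℕ) (sim : ℕ → Finset ℕ) (l t : ℕ) : ℝ :=
  coeffB p M l t / ((p : ℝ) - (n : ℝ) - memShare M l t * ((sim (t - l)).card : ℝ) - 1)

/-- `Γ_t(a)`. -/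
noncomputable def coeffGamma (p n M : ℕ) (sim : ℕ → Finset ℕ) (dis : ℕ → List ℕ) (t a : ℕ) : ℝ :=
  ∏ l ∈ Finset.range a,
    ((1 - coeffB p M l t) ^ (dis (t - l)).length *
      coeffR p n (memShare M l t * ((sim (t - l)).card : ℝ)))

/-- `Λ_{a,σ}`. -/
noncomputable def coeffLambda (p : ℕ) (a : ℝ) (σ : ℝ≥0) : ℝ :=
  a * (σ : ℝ) ^ 2 / ((p : ℝ) - a - 1)

/-- Indicator that task `j` belongs to `sim t`. -/
def indSim (sim : ℕ → Finset ℕ) (t j : ℕ) : ℝ := if j ∈ sim t then 1 else 0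

/-- Indicator that task `j` belongs to `dis t`. -/
def indDis (dis : ℕ → List ℕ) (t j : ℕ) : ℝ := if j ∈ dis t then 1 else 0

/-- `f_t(j)`: the position, counted from 1, of `j` in the list `dis t`. -/
def disPos (dis : ℕ → List ℕ) (t j : ℕ) : ℕ := (dis t).idxOf j + 1

/-- `d_{0t}`. -/
noncomputable def hybridD0 (p n M : ℕ) (sim : ℕ → Finset ℕ) (dis : ℕ → List ℕ) (t : ℕ) : ℝ :=
  coeffR p n 0 * coeffGamma p n M sim dis t (t - 1)

/-- `d_{ijkt}` (used for `i ≤ t` only). -/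
noncomputable def hybridD (p n M : ℕ) (sim : ℕ → Finset ℕ) (dis : ℕ → List ℕ)
    (i j k t : ℕ) : ℝ :=
  if k = i ∧ j < t then
    (∑ l ∈ Finset.range (t - j),
      (1 - coeffB p M l t) ^ (dis (t - l)).length * coeffGamma p n M sim dis t l *
        coeffB p M l t * indSim sim (t - l) j)
    + (∑ l ∈ Finset.range (t - 1),
      (1 - coeffB p M l t) ^ (dis (t - l)).length * coeffGamma p n M sim dis t l *
        ((p : ℝ) * coeffB p M l t * coeffK p n M sim l t) *
        indSim sim (t - l) j * indSim sim (t - l) k)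
    + (1 - coeffB p M (t - k) t) ^ (dis k).length * (n : ℝ) *
        coeffGamma p n M sim dis t (t - k) * coeffK p n M sim (t - k) t * indSim sim k j
    + (1 - coeffB p M (t - j) t) ^ (dis j).length * (n : ℝ) *
        coeffGamma p n M sim dis t (t - j) * coeffK p n M sim (t - j) t * indSim sim j k
    + (1 - coeffB p M (t - j) t) ^ (dis j).length * coeffGamma p n M sim dis t (t - j) *
        (1 - coeffR p n 0)
    + ∑ l ∈ Finset.range (t - j),
      coeffGamma p n M sim dis t l *
        (1 - coeffB p M l t) ^ ((dis (t - l)).length - disPos dis (t - l) j) *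
        coeffB p M l t * indDis dis (t - l) j
  else if k = i ∧ j = t then
    (1 - coeffB p M 0 t) ^ (dis t).length *
      ((1 - coeffR p n 0) + (n : ℝ) * coeffK p n M sim 0 t * indSim sim t i)
  else if j < k ∧ k < t ∧ j ≠ i ∧ k ≠ i then
    (∑ l ∈ Finset.range (t - 1),
      (1 - coeffB p M l t) ^ (dis (t - l)).length * coeffGamma p n M sim dis t l *
        ((p : ℝ) * coeffB p M l t * coeffK p n M sim l t) *
        indSim sim (t - l) j * indSim sim (t - l) k)
    + (1 - coeffB p M (t - k) t) ^ (dis k).length * (n : ℝ) *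
        coeffGamma p n M sim dis t (t - k) * coeffK p n M sim (t - k) t * indSim sim k j
  else if j < k ∧ k = t ∧ j ≠ i ∧ k ≠ i then
    (1 - coeffB p M 0 t) ^ (dis t).length * (n : ℝ) * coeffK p n M sim 0 t * indSim sim t j
  else 0

/-- `c_i`. -/
noncomputable def hybridC0 (p n M : ℕ) (sim : ℕ → Finset ℕ) (dis : ℕ → List ℕ) (T i : ℕ) : ℝ :=
  hybridD0 p n M sim dis T - hybridD0 p n M sim dis i

/-- `c_{ijk}`. -/
noncomputable def hybridC (p n M : ℕ) (sim : ℕ → Finset ℕ) (dis : ℕ → List ℕ)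
    (T i j k : ℕ) : ℝ :=
  hybridD p n M sim dis i j k T - hybridD p n M sim dis i j k i

/-- `noise_t(σ)`. -/
noncomputable def hybridNoise (p n M : ℕ) (sim : ℕ → Finset ℕ) (dis : ℕ → List ℕ) (t : ℕ)
    (σ : ℝ≥0) : ℝ :=
  (∑ l ∈ Finset.range (t - 1),
    coeffGamma p n M sim dis t l *
      ((∑ j ∈ (dis (t - l)).toFinset,
          (1 - coeffB p M l t) ^ ((dis (t - l)).length - disPos dis (t - l) j) *
            coeffLambda p (memShare M l t) σ)
        + (1 - coeffB p M l t) ^ (dis (t - l)).length *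
            coeffLambda p ((n : ℝ) + (p : ℝ) * ((sim (t - l)).card : ℝ) * coeffB p M l t) σ))
  + coeffGamma p n M sim dis t (t - 1) * coeffLambda p (n : ℝ) σ

/-! Training on a set of samples projects the current parameters orthogonally onto an affine
subspace, and this projection can be built one sample at a time. The state is a pair (Q, w): Q
projects onto the orthogonal complement of the features already fitted in the block, and w is the
projection of the starting point reached so far. A sample (x, y) moves w by (y - ⟨x, w⟩)/‖Qx‖² · Qx
and removes the direction Qx from Q (`sampleStep`). Given the past, x is a fresh standard Gaussian
vector, so the moments E[1/‖Qx‖²] = 1/(d-2) and E[⟨x,g⟩⟨x,h⟩/‖Qx‖²] = ⟨Qg,h⟩/d + ⟨g-Qg,h⟩/(d-2),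
with d = rank Q ≥ 3, suffice (`IsOrthProj.integral_inner_mul_inner_div`).

Hence the expectations of ‖Qu‖², ‖Q(w-θ)‖² and ‖w-θ‖² obey a closed linear recursion, solved in
`IndepSamples.block`: fitting L samples with ground truths v_s multiplies the expected squared
distance to θ by 1 - L/p and adds (1/p)∑‖v_s-θ‖², a pair term ∑‖v_r-v_s‖² over unordered pairs
divided by p(p-L-1), and the noise Lσ²/(p-L-1). The pair term is the price of fitting different
ground truths at once; it vanishes for a block from one task.

A task is one such block for the current data and the `sim` memories, then one block for each `dis`
memory. All samples are fresh, so the expected error after a task is an affine function of the one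
before (`taskError`), and unrolling down to w_0 = 0 produces the products Γ_t (`expectedError_eq`).
What remains is sorting. The result consists of terms ‖w*_j - w*_i‖² from fitting task j and of pair
terms that do not depend on i; the coefficients d_{ijkt} file the pairs containing i under k = i and
all other pairs under j < k (`sum_taskIncrement`, `sum_hybridD_mul`). -/

open MeasureTheory ProbabilityTheory
open scoped RealInnerProductSpace

/-! ### Gaussian moments with a sum of squares in the denominator. -/

lemma gaussianReal_tilt {s : ℝ} (hs : 0 ≤ s) {f : ℝ → ENNReal} (hf : Measurable f) :
    ∫⁻ y, f y * ENNReal.ofReal (Real.exp (-(s * y ^ 2))) ∂(gaussianReal 0 1) =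
      ENNReal.ofReal (√(1 / (1 + 2 * s))) *
        ∫⁻ y, f y ∂(gaussianReal 0 (1 / (1 + 2 * s)).toNNReal) := by
  have hpos : 0 < 1 + 2 * s := by positivity
  have hv : (1 / (1 + 2 * s)).toNNReal ≠ 0 := by
    simp only [ne_eq, Real.toNNReal_eq_zero, not_le]; positivity
  have hvc : (((1 / (1 + 2 * s)).toNNReal : ℝ≥0) : ℝ) = 1 / (1 + 2 * s) :=
    Real.coe_toNNReal _ (by positivity)
  rw [gaussianReal_of_var_ne_zero _ one_ne_zero, gaussianReal_of_var_ne_zero _ hv,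
    lintegral_withDensity_eq_lintegral_mul _ (measurable_gaussianPDF _ _) (by fun_prop),
    lintegral_withDensity_eq_lintegral_mul _ (measurable_gaussianPDF _ _) hf,
    ← lintegral_const_mul _ (by fun_prop)]
  refine lintegral_congr fun y => ?_
  -- The factor exp(-s y²) turns the density of N(0,1) into √a times the density of N(0,a), where a
  -- = 1/(1+2s).
  have key : gaussianPDF 0 1 y * ENNReal.ofReal (Real.exp (-(s * y ^ 2))) =
      ENNReal.ofReal (√(1 / (1 + 2 * s))) * gaussianPDF 0 (1 / (1 + 2 * s)).toNNReal y := by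
    rw [gaussianPDF, gaussianPDF, ← ENNReal.ofReal_mul (gaussianPDFReal_nonneg _ _ _),
      ← ENNReal.ofReal_mul (Real.sqrt_nonneg _)]
    congr 1
    rw [gaussianPDFReal, gaussianPDFReal, hvc]
    have h1 : √(2 * Real.pi * (1 / (1 + 2 * s))) = √(2 * Real.pi) * √(1 / (1 + 2 * s)) :=
      Real.sqrt_mul (by positivity) _
    have h2 : 0 < √(1 / (1 + 2 * s)) := Real.sqrt_pos.2 (by positivity)
    have h3 : 0 < √(2 * Real.pi) := Real.sqrt_pos.2 (by positivity)
    rw [h1, mul_assoc, ← Real.exp_add, ← mul_assoc]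
    congr 1
    · simp only [NNReal.coe_one, mul_one]; field_simp
    · congr 1
      simp only [NNReal.coe_one, mul_one]; field_simp; ring
  simp only [Pi.mul_apply]
  rw [mul_left_comm, key]
  ring

lemma integral_sq_gaussianReal (v : ℝ≥0) : ∫ y, y ^ 2 ∂(gaussianReal 0 v) = v := by
  have h1 := variance_fun_id_gaussianReal (μ := 0) (v := v)
  rw [variance_of_integral_eq_zero (by fun_prop) (by simp)] at h1
  simpa using h1

lemma lintegral_sq_gaussianReal (v : ℝ≥0) :
    ∫⁻ y, ENNReal.ofReal (y ^ 2) ∂(gaussianReal 0 v) = v := by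
  rw [← ofReal_integral_eq_lintegral_ofReal, integral_sq_gaussianReal]
  · simp
  · exact (memLp_id_gaussianReal 2).integrable_sq
  · exact Filter.Eventually.of_forall fun y => sq_nonneg y

section Coordinates

variable {ι : Type*} [Fintype ι] [DecidableEq ι]

/-- The integral factorizes over coordinates. With a = 1/(1+2s), each j ∈ S gives √a from the tilt,
each j ∈ S ∩ T in addition the tilted variance a = √a², and each j ∈ T \ S the variance 1. -/
lemma lintegral_prod_sq_mul_exp_neg (S T : Finset ι) {s : ℝ} (hs : 0 ≤ s) :
    ∫⁻ y, (∏ j ∈ T, ENNReal.ofReal (y j ^ 2)) *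
        ENNReal.ofReal (Real.exp (-(s * ∑ j ∈ S, y j ^ 2)))
        ∂(Measure.pi fun _ : ι => gaussianReal 0 1) =
      ENNReal.ofReal (√(1 / (1 + 2 * s)) ^ (S.card + 2 * (S ∩ T).card)) := by
  set a : ℝ := 1 / (1 + 2 * s) with ha
  have ha0 : 0 < a := by positivity
  let F : ι → ℝ → ENNReal := fun j y =>
    (if j ∈ T then ENNReal.ofReal (y ^ 2) else 1) *
      (if j ∈ S then ENNReal.ofReal (Real.exp (-(s * y ^ 2))) else 1)
  have hF : ∀ j, Measurable (F j) := fun j => by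
    dsimp only [F]; split_ifs <;> fun_prop
  have hprod : ∀ y : ι → ℝ, (∏ j ∈ T, ENNReal.ofReal (y j ^ 2)) *
      ENNReal.ofReal (Real.exp (-(s * ∑ j ∈ S, y j ^ 2))) = ∏ j, F j (y j) := by
    intro y
    rw [Finset.prod_mul_distrib]
    congr 1
    · rw [Finset.prod_ite_mem, Finset.univ_inter]
    · rw [Finset.prod_ite_mem, Finset.univ_inter, Finset.mul_sum, ← Finset.sum_neg_distrib,
        Real.exp_sum, ENNReal.ofReal_prod_of_nonneg fun _ _ => (Real.exp_pos _).le]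
  simp_rw [hprod]
  rw [lintegral_prod_eq_prod_lintegral_of_indepFun Finset.univ (fun j (y : ι → ℝ) => F j (y j))
    (iIndepFun_pi fun j => (hF j).aemeasurable) (fun j => (hF j).comp (measurable_pi_apply j))]
  have h1 : ∀ j, ∫⁻ y : ι → ℝ, F j (y j) ∂(Measure.pi fun _ : ι => gaussianReal 0 1) =
      (if j ∈ S then ENNReal.ofReal (√a) else 1) *
        (if j ∈ S ∩ T then ENNReal.ofReal (√a ^ 2) else 1) := by
    intro j
    rw [← lintegral_map (f := F j) (hF j) (measurable_pi_apply j),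
      (measurePreserving_eval _ j).map_eq]
    by_cases hjS : j ∈ S <;> by_cases hjT : j ∈ T
    · simp only [F, hjS, hjT, if_true, Finset.mem_inter, and_self]
      rw [gaussianReal_tilt hs (by fun_prop), lintegral_sq_gaussianReal, Real.sq_sqrt ha0.le]
      rfl
    · have := gaussianReal_tilt hs (f := fun _ => 1) measurable_const
      simpa [F, hjS, hjT, ha] using this
    · simp [F, hjS, hjT, lintegral_sq_gaussianReal]
    · simp [F, hjS, hjT]
  simp_rw [h1]
  rw [Finset.prod_mul_distrib, Finset.prod_ite_mem, Finset.prod_ite_mem, Finset.univ_inter,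
    Finset.univ_inter, Finset.prod_const, Finset.prod_const, pow_add, pow_mul,
    ENNReal.ofReal_mul (by positivity), ENNReal.ofReal_pow (by positivity),
    ENNReal.ofReal_pow (by positivity), ENNReal.ofReal_pow (by positivity),
    ENNReal.ofReal_pow (by positivity)]

end Coordinates

lemma lintegral_Ioi_sqrt_pow {N : ℕ} (hN : 3 ≤ N) :
    ∫⁻ s in Set.Ioi (0 : ℝ), ENNReal.ofReal (√(1 / (1 + 2 * s)) ^ N) =
      ENNReal.ofReal (1 / ((N : ℝ) - 2)) := by
  have hN' : (3 : ℝ) ≤ N := by exact_mod_cast hN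
  -- An antiderivative of (1+2s)^(-N/2); it tends to 0 at infinity because N > 2.
  let g : ℝ → ℝ := fun s => (1 + 2 * s) ^ (1 - (N : ℝ) / 2) / (2 - N)
  let g' : ℝ → ℝ := fun s => (1 + 2 * s) ^ (-((N : ℝ) / 2))
  have hderiv : ∀ s ∈ Set.Ici (0 : ℝ), HasDerivAt g (g' s) s := by
    intro s hs
    have hs : 0 ≤ s := hs
    have h1 : HasDerivAt (fun s : ℝ => 1 + 2 * s) 2 s := by
      simpa using ((hasDerivAt_id s).const_mul 2).const_add 1
    have h2 := (h1.rpow_const (p := 1 - (N : ℝ) / 2) (Or.inl (by positivity))).div_const (2 - N)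
    refine h2.congr_deriv ?_
    have : (1 - (N : ℝ) / 2 - 1) = -((N : ℝ) / 2) := by ring
    rw [this]
    have h3 : (2 : ℝ) - N ≠ 0 := by linarith
    simp only [g']; field_simp
  have hpos : ∀ s ∈ Set.Ioi (0 : ℝ), 0 ≤ g' s := fun s hs => by
    have hs : 0 < s := hs
    simp only [g']; positivity
  have htend : Filter.Tendsto g Filter.atTop (nhds 0) := by
    have h1 : Filter.Tendsto (fun s : ℝ => 1 + 2 * s) Filter.atTop Filter.atTop :=
      Filter.tendsto_atTop_add_const_left _ _ (Filter.tendsto_id.const_mul_atTop two_pos)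
    have h2 := (tendsto_rpow_neg_atTop (y := (N : ℝ) / 2 - 1) (by linarith)).comp h1
    have h3 := h2.div_const (2 - (N : ℝ))
    rw [zero_div] at h3
    refine h3.congr fun s => ?_
    simp only [g, Function.comp_def, neg_sub]
  have hint := integrableOn_Ioi_deriv_of_nonneg' hderiv hpos htend
  have hval := integral_Ioi_of_hasDerivAt_of_nonneg' hderiv hpos htend
  have hcongr : ∫⁻ s in Set.Ioi (0 : ℝ), ENNReal.ofReal (√(1 / (1 + 2 * s)) ^ N) =
      ∫⁻ s in Set.Ioi (0 : ℝ), ENNReal.ofReal (g' s) := by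
    refine setLIntegral_congr_fun measurableSet_Ioi fun s hs => ?_
    have hs : 0 < s := hs
    have h0 : 0 < 1 + 2 * s := by positivity
    simp only [g']
    congr 1
    rw [Real.sqrt_eq_rpow, ← Real.rpow_natCast, ← Real.rpow_mul (by positivity), one_div,
      Real.inv_rpow h0.le, Real.rpow_neg h0.le]
    ring_nf
  rw [hcongr, ← ofReal_integral_eq_lintegral_ofReal hint, hval]
  · congr 1
    simp only [g]
    simp only [mul_zero, add_zero, Real.one_rpow, zero_sub]
    rw [← neg_sub (N : ℝ) 2, one_div, one_div, inv_neg, neg_neg]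
  · filter_upwards [ae_restrict_mem measurableSet_Ioi] with s hs using hpos s hs

section Coordinates

variable {ι : Type*} [Fintype ι] [DecidableEq ι]

omit [DecidableEq ι] in
lemma sum_sq_pos_ae {S : Finset ι} (hS : S.Nonempty) :
    ∀ᵐ y ∂(Measure.pi fun _ : ι => gaussianReal 0 1), 0 < ∑ j ∈ S, y j ^ 2 := by
  obtain ⟨i, hi⟩ := hS
  have h1 : ∀ᵐ a ∂(gaussianReal 0 1), a ≠ 0 := by
    have := nullSingletonClass_gaussianReal (μ := 0) (v := 1) one_ne_zero
    rw [ae_iff]; simp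
  have h2 := (measurePreserving_eval (fun _ : ι => gaussianReal 0 1) i).quasiMeasurePreserving.ae h1
  filter_upwards [h2] with y hy
  exact Finset.sum_pos' (fun _ _ => sq_nonneg _) ⟨i, hi, by positivity⟩

lemma lintegral_exp_neg_mul {r : ℝ} (hr : 0 < r) :
    ∫⁻ s in Set.Ioi (0 : ℝ), ENNReal.ofReal (Real.exp (-(s * r))) = ENNReal.ofReal (1 / r) := by
  rw [← ofReal_integral_eq_lintegral_ofReal]
  · congr 1
    have := integral_exp_mul_Ioi (a := -r) (by linarith) 0
    simp only [mul_zero, Real.exp_zero, neg_div_neg_eq] at this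
    rw [← this]
    refine integral_congr_ae (Filter.Eventually.of_forall fun s => ?_)
    simp only; ring_nf
  · have := integrableOn_exp_mul_Ioi (a := -r) (by linarith) 0
    refine this.congr_fun (fun s _ => ?_) measurableSet_Ioi
    simp only; ring_nf
  · exact Filter.Eventually.of_forall fun s => (Real.exp_pos _).le

/-- Writing 1/r = ∫₀^∞ exp(-sr) ds and exchanging the integrals by Tonelli leaves, for each s, a
Gaussian integral that factorizes. A square y_j² with j ∈ S in the numerator acts like two more
degrees of freedom. -/
lemma lintegral_prod_sq_div_sum_sq {S : Finset ι} (hS : S.Nonempty) (T : Finset ι)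
    (hST : 3 ≤ S.card + 2 * (S ∩ T).card) :
    ∫⁻ y, (∏ j ∈ T, ENNReal.ofReal (y j ^ 2)) * ENNReal.ofReal (1 / ∑ j ∈ S, y j ^ 2)
        ∂(Measure.pi fun _ : ι => gaussianReal 0 1) =
      ENNReal.ofReal (1 / ((S.card + 2 * (S ∩ T).card : ℕ) - 2)) := by
  have h1 : ∫⁻ y, (∏ j ∈ T, ENNReal.ofReal (y j ^ 2)) * ENNReal.ofReal (1 / ∑ j ∈ S, y j ^ 2)
        ∂(Measure.pi fun _ : ι => gaussianReal 0 1) =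
      ∫⁻ y, (∫⁻ s in Set.Ioi (0 : ℝ), (∏ j ∈ T, ENNReal.ofReal (y j ^ 2)) *
        ENNReal.ofReal (Real.exp (-(s * ∑ j ∈ S, y j ^ 2))))
        ∂(Measure.pi fun _ : ι => gaussianReal 0 1) := by
    refine lintegral_congr_ae ?_
    filter_upwards [sum_sq_pos_ae hS] with y hy
    rw [lintegral_const_mul _ (by fun_prop), lintegral_exp_neg_mul hy]
  rw [h1, lintegral_lintegral_swap, ← lintegral_Ioi_sqrt_pow hST]
  · exact setLIntegral_congr_fun measurableSet_Ioi fun s hs =>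
      lintegral_prod_sq_mul_exp_neg S T (le_of_lt hs)
  · fun_prop

lemma integral_eq_of_lintegral_ofReal_eq {α : Type*} [MeasurableSpace α] {ν : Measure α} {f : α → ℝ} {c : ℝ}
    (hf : AEStronglyMeasurable f ν) (h0 : ∀ a, 0 ≤ f a) (hc : 0 ≤ c)
    (h : ∫⁻ a, ENNReal.ofReal (f a) ∂ν = ENNReal.ofReal c) :
    Integrable f ν ∧ ∫ a, f a ∂ν = c := by
  have hint : Integrable f ν := by
    refine ⟨hf, ?_⟩
    rw [hasFiniteIntegral_iff_ofReal (Filter.Eventually.of_forall h0), h]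
    exact ENNReal.ofReal_lt_top
  refine ⟨hint, ?_⟩
  rw [integral_eq_lintegral_of_nonneg_ae (Filter.Eventually.of_forall h0) hf, h,
    ENNReal.toReal_ofReal hc]

lemma integral_inv_sum_sq {S : Finset ι} (hS : 3 ≤ S.card) :
    Integrable (fun y : ι → ℝ => 1 / ∑ j ∈ S, y j ^ 2) (Measure.pi fun _ => gaussianReal 0 1) ∧
    ∫ y : ι → ℝ, 1 / ∑ j ∈ S, y j ^ 2 ∂(Measure.pi fun _ => gaussianReal 0 1) =
      1 / ((S.card : ℝ) - 2) := by
  have hS' : (3 : ℝ) ≤ S.card := by exact_mod_cast hS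
  refine integral_eq_of_lintegral_ofReal_eq (Measurable.aestronglyMeasurable (by fun_prop)) (fun y => by positivity)
    (div_nonneg zero_le_one (by linarith)) ?_
  have := lintegral_prod_sq_div_sum_sq (Finset.card_pos.1 (by omega : 0 < S.card)) ∅ (by simpa using hS)
  simpa using this

lemma integral_sq_div_sum_sq {S : Finset ι} (hS : 3 ≤ S.card) (i : ι) :
    Integrable (fun y : ι → ℝ => y i ^ 2 / ∑ j ∈ S, y j ^ 2) (Measure.pi fun _ => gaussianReal 0 1) ∧
    ∫ y : ι → ℝ, y i ^ 2 / ∑ j ∈ S, y j ^ 2 ∂(Measure.pi fun _ => gaussianReal 0 1) =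
      if i ∈ S then 1 / (S.card : ℝ) else 1 / ((S.card : ℝ) - 2) := by
  have hS' : (3 : ℝ) ≤ S.card := by exact_mod_cast hS
  have hc : (0 : ℝ) ≤ if i ∈ S then 1 / (S.card : ℝ) else 1 / ((S.card : ℝ) - 2) := by
    split_ifs
    · positivity
    · exact div_nonneg zero_le_one (by linarith)
  refine integral_eq_of_lintegral_ofReal_eq (Measurable.aestronglyMeasurable (by fun_prop)) (fun y => by positivity) hc ?_
  have := lintegral_prod_sq_div_sum_sq (Finset.card_pos.1 (by omega : 0 < S.card)) {i}
    (le_trans hS (Nat.le_add_right _ _))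
  simp only [Finset.prod_singleton] at this
  simp_rw [div_eq_mul_one_div (_ ^ 2 : ℝ), ENNReal.ofReal_mul (sq_nonneg _)]
  rw [this]
  by_cases hi : i ∈ S
  · simp [hi]
  · simp [hi]

lemma integral_mul_div_sum_sq {S : Finset ι} (hS : 3 ≤ S.card) (i k : ι) :
    Integrable (fun y : ι → ℝ => y i * y k / ∑ j ∈ S, y j ^ 2)
      (Measure.pi fun _ => gaussianReal 0 1) ∧
    ∫ y : ι → ℝ, y i * y k / ∑ j ∈ S, y j ^ 2 ∂(Measure.pi fun _ => gaussianReal 0 1) =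
      if i = k then (if i ∈ S then 1 / (S.card : ℝ) else 1 / ((S.card : ℝ) - 2)) else 0 := by
  by_cases hik : i = k
  · subst hik
    simpa [← sq] using integral_sq_div_sum_sq hS i
  constructor
  · refine (((integral_sq_div_sum_sq hS i).1.add (integral_sq_div_sum_sq hS k).1)).mono'
      (Measurable.aestronglyMeasurable (by fun_prop)) (Filter.Eventually.of_forall fun y => ?_)
    have h0 : 0 ≤ ∑ j ∈ S, y j ^ 2 := Finset.sum_nonneg fun _ _ => sq_nonneg _
    simp only [Pi.add_apply]
    rw [← add_div, Real.norm_eq_abs, abs_div, abs_of_nonneg h0]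
    refine div_le_div_of_nonneg_right ?_ h0
    rw [abs_le]; constructor <;> nlinarith [sq_nonneg (y i + y k), sq_nonneg (y i - y k),
      sq_nonneg (y i), sq_nonneg (y k)]
  · rw [if_neg hik]
    -- Flipping the sign of coordinate i preserves the measure and negates the integrand, so
    -- off-diagonal moments vanish.
    have hmp : MeasurePreserving (fun (y : ι → ℝ) j => if j = i then -(y j) else y j)
        (Measure.pi fun _ => gaussianReal 0 1) (Measure.pi fun _ => gaussianReal 0 1) := by
      refine measurePreserving_pi (fun _ => gaussianReal 0 1) (fun _ => gaussianReal 0 1)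
        (f := fun j a => if j = i then -a else a) fun j => ?_
      by_cases hj : j = i
      · simp only [hj, if_true]
        exact ⟨measurable_neg, by simpa using gaussianReal_map_neg (μ := 0) (v := 1)⟩
      · simp only [hj, if_false]
        exact MeasurePreserving.id _
    have hneg : ∫ y : ι → ℝ, y i * y k / ∑ j ∈ S, y j ^ 2 ∂(Measure.pi fun _ => gaussianReal 0 1) =
        -∫ y : ι → ℝ, y i * y k / ∑ j ∈ S, y j ^ 2 ∂(Measure.pi fun _ => gaussianReal 0 1) := by
      conv_lhs => rw [← hmp.map_eq]
      rw [integral_map hmp.measurable.aemeasurable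
        (Measurable.aestronglyMeasurable (by fun_prop)), ← integral_neg]
      refine integral_congr_ae (Filter.Eventually.of_forall fun y => ?_)
      have : ∀ j, (if j = i then -(y j) else y j) ^ 2 = y j ^ 2 := fun j => by split_ifs <;> ring
      simp only [this, if_true, if_neg (Ne.symm hik)]
      ring
    linarith

end Coordinates

/-! ### Moments of a standard Gaussian vector relative to an orthogonal projection. -/

section Projection

variable {E : Type*} [NormedAddCommGroup E] [InnerProductSpace ℝ E]

/-- `Q` is an orthogonal projection onto a subspace of dimension `d`. -/
structure IsOrthProj (d : ℕ) (Q : E →L[ℝ] E) : Prop where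
  symm : ∀ u v, ⟪Q u, v⟫ = ⟪u, Q v⟫
  idem : ∀ u, Q (Q u) = Q u
  trace : LinearMap.trace ℝ E Q.toLinearMap = d

variable {d : ℕ} {Q : E →L[ℝ] E}

lemma IsOrthProj.inner_apply_apply (hQ : IsOrthProj d Q) (u v : E) : ⟪Q u, Q v⟫ = ⟪u, Q v⟫ := by
  rw [hQ.symm, hQ.idem]

variable [FiniteDimensional ℝ E]

/-- Idempotence forces every eigenvalue to be 0 or 1, and the trace counts the ones. -/
lemma IsOrthProj.exists_basis (hQ : IsOrthProj d Q) :
    ∃ (b : OrthonormalBasis (Fin (Module.finrank ℝ E)) ℝ E) (S : Finset (Fin (Module.finrank ℝ E))),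
      S.card = d ∧ ∀ i, Q (b i) = if i ∈ S then b i else 0 := by
  have hs : Q.toLinearMap.IsSymmetric := fun u v => hQ.symm u v
  let b := hs.eigenvectorBasis rfl
  let ev := hs.eigenvalues rfl
  have hb : ∀ i, Q (b i) = ev i • b i := fun i => hs.apply_eigenvectorBasis rfl i
  have hev : ∀ i, ev i = 0 ∨ ev i = 1 := by
    intro i
    have h1 := hQ.idem (b i)
    rw [hb, map_smul, hb, smul_smul] at h1
    have hne : b i ≠ 0 := b.orthonormal.ne_zero i
    have h2 : ev i * ev i = ev i := smul_left_injective ℝ hne h1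
    rcases eq_or_ne (ev i) 0 with h | h
    · exact Or.inl h
    · exact Or.inr (mul_left_cancel₀ h (by rw [h2, mul_one]))
  have hQb : ∀ i, Q (b i) = if i ∈ Finset.univ.filter (fun i => ev i = 1) then b i else 0 := by
    intro i
    rw [hb]
    rcases hev i with h | h <;> simp [h]
  refine ⟨b, Finset.univ.filter fun i => ev i = 1, ?_, hQb⟩
  have ht := hQ.trace
  rw [LinearMap.trace_eq_sum_inner _ b] at ht
  have h3 : ∀ i, ⟪b i, Q.toLinearMap (b i)⟫ =
      if i ∈ Finset.univ.filter (fun i => ev i = 1) then (1 : ℝ) else 0 := by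
    intro i
    rw [ContinuousLinearMap.coe_coe, hQb]
    split_ifs
    · rw [real_inner_self_eq_norm_sq, b.orthonormal.1 i]; norm_num
    · exact inner_zero_right _
  simp_rw [h3] at ht
  rw [Finset.sum_ite_mem, Finset.univ_inter, Finset.sum_const, nsmul_eq_mul, mul_one] at ht
  exact_mod_cast ht

variable [MeasurableSpace E] [BorelSpace E]

lemma integrable_stdGaussian_iff_pi {ι : Type*} [Fintype ι] (b : OrthonormalBasis ι ℝ E)
    {f : E → ℝ} (hf : Measurable f) :
    Integrable f (stdGaussian E) ↔
      Integrable (fun y : ι → ℝ => f (∑ i, y i • b i)) (Measure.pi fun _ => gaussianReal 0 1) := by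
  rw [stdGaussian_eq_map_pi_orthonormalBasis b, integrable_map_measure hf.aestronglyMeasurable
    (Measurable.aemeasurable (by fun_prop))]
  rfl

lemma integral_stdGaussian_eq_pi {ι : Type*} [Fintype ι] (b : OrthonormalBasis ι ℝ E)
    {f : E → ℝ} (hf : Measurable f) :
    ∫ x, f x ∂(stdGaussian E) =
      ∫ y : ι → ℝ, f (∑ i, y i • b i) ∂(Measure.pi fun _ => gaussianReal 0 1) := by
  rw [stdGaussian_eq_map_pi_orthonormalBasis b, integral_map (Measurable.aemeasurable (by fun_prop))
    hf.aestronglyMeasurable]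

omit [FiniteDimensional ℝ E] [MeasurableSpace E] [BorelSpace E] in
lemma norm_sq_apply_sum_smul {ι : Type*} [Fintype ι] [DecidableEq ι] (b : OrthonormalBasis ι ℝ E)
    {S : Finset ι} (hb : ∀ i, Q (b i) = if i ∈ S then b i else 0) (y : ι → ℝ) :
    ‖Q (∑ i, y i • b i)‖ ^ 2 = ∑ i ∈ S, y i ^ 2 := by
  have h1 : Q (∑ i, y i • b i) = ∑ i, (if i ∈ S then y i else 0) • b i := by
    rw [map_sum]
    refine Finset.sum_congr rfl fun i _ => ?_
    rw [map_smul, hb]; split_ifs <;> simp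
  rw [h1, ← b.sum_sq_inner_right]
  have h2 : ∀ i, ⟪b i, ∑ j, (if j ∈ S then y j else 0) • b j⟫ = if i ∈ S then y i else 0 :=
    fun i => b.orthonormal.inner_right_fintype _ i
  simp_rw [h2, ite_pow, zero_pow two_ne_zero]
  rw [Finset.sum_ite_mem, Finset.univ_inter]

lemma IsOrthProj.ae_apply_ne_zero (hQ : IsOrthProj d Q) (hd : 0 < d) :
    ∀ᵐ x ∂(stdGaussian E), Q x ≠ 0 := by
  obtain ⟨b, S, hS, hb⟩ := hQ.exists_basis
  have hm : MeasurableSet {x | Q x ≠ 0} :=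
    (measurableSet_eq_fun (f := fun x => Q x) (g := fun _ => 0) (by fun_prop) (by fun_prop)).compl
  rw [stdGaussian_eq_map_pi_orthonormalBasis b, ae_map_iff (Measurable.aemeasurable (by fun_prop)) hm]
  filter_upwards [sum_sq_pos_ae (S := S) (Finset.card_pos.1 (hS ▸ hd))] with y hy h0
  rw [← norm_sq_apply_sum_smul b hb, h0] at hy
  simp at hy

lemma IsOrthProj.integral_inv (hQ : IsOrthProj d Q) (hd : 3 ≤ d) :
    Integrable (fun x => 1 / ‖Q x‖ ^ 2) (stdGaussian E) ∧
      ∫ x, 1 / ‖Q x‖ ^ 2 ∂(stdGaussian E) = 1 / ((d : ℝ) - 2) := by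
  obtain ⟨b, S, hS, hb⟩ := hQ.exists_basis
  rw [integrable_stdGaussian_iff_pi b (by fun_prop), integral_stdGaussian_eq_pi b (by fun_prop)]
  simp_rw [norm_sq_apply_sum_smul b hb]
  subst hS
  exact integral_inv_sum_sq hd

/-- In an eigenbasis of Q only the diagonal moments survive: a direction in the range of Q
contributes 1/d, a direction in the kernel, independent of ‖Qx‖, contributes 1/(d-2). -/
lemma IsOrthProj.integral_inner_mul_inner_div (hQ : IsOrthProj d Q) (hd : 3 ≤ d) (g h : E) :
    Integrable (fun x => ⟪x, g⟫ * ⟪x, h⟫ / ‖Q x‖ ^ 2) (stdGaussian E) ∧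
      ∫ x, ⟪x, g⟫ * ⟪x, h⟫ / ‖Q x‖ ^ 2 ∂(stdGaussian E) =
        ⟪Q g, h⟫ / d + (⟪g, h⟫ - ⟪Q g, h⟫) / ((d : ℝ) - 2) := by
  obtain ⟨b, S, hS, hb⟩ := hQ.exists_basis
  rw [integrable_stdGaussian_iff_pi b (by fun_prop), integral_stdGaussian_eq_pi b (by fun_prop)]
  simp_rw [norm_sq_apply_sum_smul b hb]
  have hexp : ∀ y : Fin (Module.finrank ℝ E) → ℝ,
      ⟪∑ i, y i • b i, g⟫ * ⟪∑ i, y i • b i, h⟫ / ∑ i ∈ S, y i ^ 2 =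
        ∑ i, ∑ k, (⟪b i, g⟫ * ⟪b k, h⟫) * (y i * y k / ∑ j ∈ S, y j ^ 2) := by
    intro y
    simp_rw [sum_inner, real_inner_smul_left, Finset.sum_mul_sum, Finset.sum_div]
    refine Finset.sum_congr rfl fun i _ => Finset.sum_congr rfl fun k _ => ?_
    ring
  simp_rw [hexp]
  subst hS
  have hint := fun i k => (integral_mul_div_sum_sq (S := S) hd i k).1.const_mul
    (⟪b i, g⟫ * ⟪b k, h⟫)
  refine ⟨integrable_finsetSum _ fun i _ => integrable_finsetSum _ fun k _ => hint i k, ?_⟩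
  rw [integral_finsetSum _ fun i _ => integrable_finsetSum _ fun k _ => hint i k]
  simp_rw [integral_finsetSum _ fun k _ => hint _ k, integral_const_mul,
    (integral_mul_div_sum_sq (S := S) hd _ _).2]
  have hgh : ⟪g, h⟫ = ∑ i, ⟪b i, g⟫ * ⟪b i, h⟫ := by
    rw [← b.sum_inner_mul_inner g h]
    exact Finset.sum_congr rfl fun i _ => by rw [real_inner_comm g]
  have hQgh : ⟪Q g, h⟫ = ∑ i, if i ∈ S then ⟪b i, g⟫ * ⟪b i, h⟫ else 0 := by
    rw [← b.sum_inner_mul_inner (Q g) h]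
    refine Finset.sum_congr rfl fun i _ => ?_
    rw [hQ.symm, hb]; split_ifs
    · rw [real_inner_comm g]
    · simp
  rw [hgh, hQgh, ← Finset.sum_sub_distrib, Finset.sum_div, Finset.sum_div, ← Finset.sum_add_distrib]
  refine Finset.sum_congr rfl fun i _ => ?_
  rw [Finset.sum_eq_single i (fun k _ hk => by rw [if_neg (Ne.symm hk), mul_zero])
    (fun hi => absurd (Finset.mem_univ i) hi), if_pos rfl]
  split_ifs <;> ring

end Projection

/-! ### The effect of one additional sample. -/

section Step

variable {E : Type*} [NormedAddCommGroup E] [InnerProductSpace ℝ E]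

/-- Adding a sample `(x, y)` to a block: `Q` projects onto the orthogonal complement of the previous
feature vectors of the block, `w` fits the previous samples. -/
noncomputable def sampleStep (s : (E →L[ℝ] E) × E) (x : E) (y : ℝ) : (E →L[ℝ] E) × E :=
  (s.1 - (1 / ‖s.1 x‖ ^ 2) • (innerSL ℝ (s.1 x)).smulRight (s.1 x),
    s.2 + ((y - ⟪x, s.2⟫) / ‖s.1 x‖ ^ 2) • s.1 x)

lemma sampleStep_fst_apply (s : (E →L[ℝ] E) × E) (x : E) (y : ℝ) (u : E) :
    (sampleStep s x y).1 u = s.1 u - (⟪s.1 x, u⟫ / ‖s.1 x‖ ^ 2) • s.1 x := by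
  simp [sampleStep, smul_smul, div_eq_inv_mul]

lemma sampleStep_snd (s : (E →L[ℝ] E) × E) (x : E) (y : ℝ) :
    (sampleStep s x y).2 = s.2 + ((y - ⟪x, s.2⟫) / ‖s.1 x‖ ^ 2) • s.1 x := rfl

lemma IsOrthProj.id [FiniteDimensional ℝ E] :
    IsOrthProj (Module.finrank ℝ E) (ContinuousLinearMap.id ℝ E) :=
  ⟨fun _ _ => rfl, fun _ => rfl, LinearMap.trace_id ℝ E⟩

/-- What is subtracted is the projection onto the line through Qx, of trace 1. Recording the
dimension as a trace makes this count linear. -/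
lemma IsOrthProj.sampleStep {d : ℕ} {s : (E →L[ℝ] E) × E} [FiniteDimensional ℝ E]
    (hs : IsOrthProj (d + 1) s.1) {x : E} (hx : s.1 x ≠ 0) (y : ℝ) :
    IsOrthProj d (sampleStep s x y).1 := by
  have hr : ‖s.1 x‖ ^ 2 ≠ 0 := by simpa using hx
  refine ⟨fun u v => ?_, fun u => ?_, ?_⟩
  · simp only [sampleStep_fst_apply, inner_sub_left, inner_sub_right, real_inner_smul_left,
      real_inner_smul_right, hs.symm u v, real_inner_comm (s.1 x) u]
    ring
  · have h1 : ⟪s.1 x, s.1 u⟫ = ⟪s.1 x, u⟫ := by rw [← hs.symm, hs.idem]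
    simp only [sampleStep_fst_apply, map_sub, map_smul, hs.idem, real_inner_self_eq_norm_sq, h1]
    rw [div_self hr]
    simp
  · have h1 : ((_root_.sampleStep s x y).1).toLinearMap = s.1.toLinearMap -
        (1 / ‖s.1 x‖ ^ 2) • ((innerSL ℝ (s.1 x)).toLinearMap.smulRight (s.1 x)) := by
      ext u; simp [_root_.sampleStep]
    rw [h1, map_sub, map_smul, LinearMap.trace_smulRight, hs.trace]
    simp [hr]

/-- Arranged as a polynomial in the noise z with coefficients depending on x only, so that each term
integrates as a product. For Qx = 0 all quotients are 0 and the identity still holds. -/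
lemma norm_sq_sampleStep_snd_sub {d : ℕ} {s : (E →L[ℝ] E) × E} (hs : IsOrthProj d s.1)
    (x v θ : E) (z : ℝ) :
    ‖(sampleStep s x (⟪x, v⟫ + z)).2 - θ‖ ^ 2 =
      ‖s.2 - θ‖ ^ 2 + 2 * (⟪x, v - s.2⟫ * ⟪x, s.1 (s.2 - θ)⟫ / ‖s.1 x‖ ^ 2)
        + ⟪x, v - s.2⟫ * ⟪x, v - s.2⟫ / ‖s.1 x‖ ^ 2
        + (2 * (⟪x, v - s.2 + s.1 (s.2 - θ)⟫ / ‖s.1 x‖ ^ 2)) * z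
        + 1 / ‖s.1 x‖ ^ 2 * z ^ 2 := by
  have h1 : (sampleStep s x (⟪x, v⟫ + z)).2 - θ =
      (s.2 - θ) + ((⟪x, v - s.2⟫ + z) / ‖s.1 x‖ ^ 2) • s.1 x := by
    rw [sampleStep_snd, inner_sub_right]
    rw [add_sub_right_comm]; congr 3; ring
  rw [h1, norm_add_sq_real, real_inner_smul_right, norm_smul, mul_pow, Real.norm_eq_abs, sq_abs,
    ← hs.symm, real_inner_comm x (s.1 (s.2 - θ)), inner_add_right]
  rcases eq_or_ne (‖s.1 x‖ ^ 2) 0 with hr | hr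
  · simp [hr]
  · field_simp
    ring

lemma norm_sq_sampleStep_fst_apply {d : ℕ} {s : (E →L[ℝ] E) × E} (hs : IsOrthProj d s.1)
    (x u : E) (y : ℝ) :
    ‖(sampleStep s x y).1 u‖ ^ 2 = ‖s.1 u‖ ^ 2 - ⟪x, s.1 u⟫ * ⟪x, s.1 u⟫ / ‖s.1 x‖ ^ 2 := by
  rw [sampleStep_fst_apply, norm_sub_sq_real, real_inner_smul_right, norm_smul, mul_pow,
    Real.norm_eq_abs, sq_abs, hs.symm x u, hs.symm u, hs.idem, ← hs.symm u, real_inner_comm x (s.1 u)]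
  rcases eq_or_ne (‖s.1 x‖ ^ 2) 0 with hr | hr
  · simp [hr]
  · field_simp
    ring

/-- The correction of w is a multiple of Qx, which the new projection annihilates. -/
lemma sampleStep_fst_apply_snd_sub {d : ℕ} {s : (E →L[ℝ] E) × E} (hs : IsOrthProj d s.1)
    (x θ : E) (y : ℝ) :
    (sampleStep s x y).1 ((sampleStep s x y).2 - θ) = (sampleStep s x y).1 (s.2 - θ) := by
  have h0 : (sampleStep s x y).1 (s.1 x) = 0 := by
    rw [sampleStep_fst_apply, hs.idem, real_inner_self_eq_norm_sq]
    rcases eq_or_ne (s.1 x) 0 with hr | hr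
    · simp [hr]
    · rw [div_self (by simpa using hr), one_smul, sub_self]
  rw [sampleStep_snd, add_sub_right_comm, map_add, map_smul, h0, smul_zero, add_zero]

variable [FiniteDimensional ℝ E] [MeasurableSpace E] [BorelSpace E]

variable (E) in
/-- Joint law of the feature vector and the noise of one sample. -/
noncomputable def sampleLaw (σ : ℝ≥0) : Measure (E × ℝ) :=
  (stdGaussian E).prod (gaussianReal 0 (σ ^ 2))

instance (σ : ℝ≥0) : IsProbabilityMeasure (sampleLaw E σ) := by
  unfold sampleLaw; infer_instance

lemma measurable_sampleStep :
    Measurable fun q : ((E →L[ℝ] E) × E) × (E × ℝ) => sampleStep q.1 q.2.1 q.2.2 := by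
  unfold sampleStep
  refine Measurable.prodMk ?_ (by fun_prop)
  refine Measurable.sub (by fun_prop) (Measurable.smul (f := fun q : ((E →L[ℝ] E) × E) × (E × ℝ) =>
    1 / ‖q.1.1 q.2.1‖ ^ 2) (by fun_prop) ?_)
  have h1 : Continuous fun u : E => (innerSL ℝ u).smulRight u := by fun_prop
  exact h1.measurable.comp (by fun_prop)

lemma IsOrthProj.integrable_inner_div {d : ℕ} {Q : E →L[ℝ] E} (hQ : IsOrthProj d Q) (hd : 3 ≤ d)
    (u : E) : Integrable (fun x => ⟪x, u⟫ / ‖Q x‖ ^ 2) (stdGaussian E) := by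
  refine (((hQ.integral_inner_mul_inner_div hd u u).1.add (hQ.integral_inv hd).1)).mono'
    (Measurable.aestronglyMeasurable (by fun_prop)) (Filter.Eventually.of_forall fun x => ?_)
  simp only [Pi.add_apply]
  rw [← add_div, Real.norm_eq_abs, abs_div, abs_of_nonneg (sq_nonneg ‖Q x‖)]
  refine div_le_div_of_nonneg_right ?_ (sq_nonneg _)
  -- This is |a| ≤ a² + 1.
  rw [abs_le]; constructor <;> nlinarith [sq_nonneg (⟪x, u⟫ + 1), sq_nonneg (⟪x, u⟫ - 1)]

/-- Expected error after one further sample. -/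
lemma IsOrthProj.integral_norm_sq_sampleStep_snd_sub {d : ℕ} {s : (E →L[ℝ] E) × E}
    (hs : IsOrthProj d s.1) (hd : 3 ≤ d) (σ : ℝ≥0) (v θ : E) :
    Integrable (fun q : E × ℝ => ‖(_root_.sampleStep s q.1 (⟪q.1, v⟫ + q.2)).2 - θ‖ ^ 2)
        (sampleLaw E σ) ∧
      ∫ q, ‖(_root_.sampleStep s q.1 (⟪q.1, v⟫ + q.2)).2 - θ‖ ^ 2 ∂(sampleLaw E σ) =
        ‖s.2 - θ‖ ^ 2 + (‖s.1 (v - θ)‖ ^ 2 - ‖s.1 (s.2 - θ)‖ ^ 2) / d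
          + (‖s.2 - v‖ ^ 2 - ‖s.1 (s.2 - v)‖ ^ 2 + (σ : ℝ) ^ 2) / ((d : ℝ) - 2) := by
  simp_rw [norm_sq_sampleStep_snd_sub hs]
  unfold sampleLaw
  have J1 := hs.integral_inner_mul_inner_div hd (v - s.2) (s.1 (s.2 - θ))
  have J2 := hs.integral_inner_mul_inner_div hd (v - s.2) (v - s.2)
  have J3 := hs.integrable_inner_div hd (v - s.2 + s.1 (s.2 - θ))
  have J4 := hs.integral_inv hd
  have hz : Integrable (fun z : ℝ => z) (gaussianReal 0 (σ ^ 2)) :=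
    (memLp_id_gaussianReal 1).integrable le_rfl
  have hz2 : Integrable (fun z : ℝ => z ^ 2) (gaussianReal 0 (σ ^ 2)) :=
    (memLp_id_gaussianReal 2).integrable_sq
  have i0 : Integrable (fun _ : E × ℝ => ‖s.2 - θ‖ ^ 2)
      ((stdGaussian E).prod (gaussianReal 0 (σ ^ 2))) := integrable_const _
  have i1 := (J1.1.const_mul 2).comp_fst (gaussianReal 0 (σ ^ 2))
  have i2 := J2.1.comp_fst (gaussianReal 0 (σ ^ 2))
  have i3 := (J3.const_mul 2).mul_prod hz
  have i4 := J4.1.mul_prod hz2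
  refine ⟨(((i0.add i1).add i2).add i3).add i4, ?_⟩
  have e4 := integral_add (((i0.add i1).add i2).add i3) i4
  have e3 := integral_add ((i0.add i1).add i2) i3
  have e2 := integral_add (i0.add i1) i2
  have e1 := integral_add i0 i1
  simp only [Pi.add_apply] at e1 e2 e3 e4
  rw [e4, e3, e2, e1, integral_prod_mul (fun x => 2 * (⟪x, v - s.2 + s.1 (s.2 - θ)⟫ / ‖s.1 x‖ ^ 2))
    (fun z : ℝ => z), integral_prod_mul (fun x => 1 / ‖s.1 x‖ ^ 2) (fun z : ℝ => z ^ 2),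
    integral_fun_fst (fun x => 2 * (⟪x, v - s.2⟫ * ⟪x, s.1 (s.2 - θ)⟫ / ‖s.1 x‖ ^ 2)),
    integral_fun_fst (fun x => ⟪x, v - s.2⟫ * ⟪x, v - s.2⟫ / ‖s.1 x‖ ^ 2),
    integral_const_mul, J1.2, J2.2, J4.2, integral_sq_gaussianReal]
  have hid : ∫ z : ℝ, z ∂(gaussianReal 0 (σ ^ 2)) = 0 := by simp
  rw [hid]
  simp only [integral_const, probReal_univ, mul_zero, add_zero, smul_eq_mul,
    one_mul, NNReal.coe_pow]
  -- Since ⟨v-w, Q(w-θ)⟩ = ⟨Q(v-w), Q(w-θ)⟩, the mixed moment has no 1/(d-2) part.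
  rw [← hs.inner_apply_apply (v - s.2) (s.2 - θ)]
  -- With this splitting, 2⟨Q(v-w), Q(w-θ)⟩ + ‖Q(v-w)‖² equals ‖Q(v-θ)‖² - ‖Q(w-θ)‖², the numerator
  -- over d.
  have h1 : s.1 (v - θ) = s.1 (v - s.2) + s.1 (s.2 - θ) := by rw [← map_add]; congr 1; abel
  have h2 : ⟪s.1 (v - s.2), v - s.2⟫ = ‖s.1 (v - s.2)‖ ^ 2 := by
    rw [← real_inner_self_eq_norm_sq, hs.symm, hs.symm, hs.idem]
  have h3 : ‖s.1 (s.2 - v)‖ = ‖s.1 (v - s.2)‖ := by rw [← neg_sub, map_neg, norm_neg]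
  rw [h1, norm_add_sq_real, h2, h3, norm_sub_rev s.2 v, real_inner_self_eq_norm_sq]
  ring

lemma IsOrthProj.integral_norm_sq_sampleStep_fst_apply {d : ℕ} {s : (E →L[ℝ] E) × E}
    (hs : IsOrthProj d s.1) (hd : 3 ≤ d) (σ : ℝ≥0) (v u : E) :
    Integrable (fun q : E × ℝ => ‖(_root_.sampleStep s q.1 (⟪q.1, v⟫ + q.2)).1 u‖ ^ 2)
        (sampleLaw E σ) ∧
      ∫ q, ‖(_root_.sampleStep s q.1 (⟪q.1, v⟫ + q.2)).1 u‖ ^ 2 ∂(sampleLaw E σ) =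
        (1 - 1 / (d : ℝ)) * ‖s.1 u‖ ^ 2 := by
  simp_rw [norm_sq_sampleStep_fst_apply hs]
  unfold sampleLaw
  have J1 := hs.integral_inner_mul_inner_div hd (s.1 u) (s.1 u)
  have i0 : Integrable (fun _ : E × ℝ => ‖s.1 u‖ ^ 2)
      ((stdGaussian E).prod (gaussianReal 0 (σ ^ 2))) := integrable_const _
  have i1 := J1.1.comp_fst (gaussianReal 0 (σ ^ 2))
  refine ⟨i0.sub i1, ?_⟩
  rw [integral_sub i0 i1, integral_fun_fst (fun x => ⟪x, s.1 u⟫ * ⟪x, s.1 u⟫ / ‖s.1 x‖ ^ 2), J1.2,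
    hs.idem, real_inner_self_eq_norm_sq]
  simp only [integral_const, probReal_univ, one_smul]
  ring

lemma IsOrthProj.integral_norm_sq_sampleStep_fst_apply_snd_sub {d : ℕ} {s : (E →L[ℝ] E) × E}
    (hs : IsOrthProj d s.1) (hd : 3 ≤ d) (σ : ℝ≥0) (v θ : E) :
    Integrable (fun q : E × ℝ => ‖(_root_.sampleStep s q.1 (⟪q.1, v⟫ + q.2)).1
        ((_root_.sampleStep s q.1 (⟪q.1, v⟫ + q.2)).2 - θ)‖ ^ 2) (sampleLaw E σ) ∧
      ∫ q, ‖(_root_.sampleStep s q.1 (⟪q.1, v⟫ + q.2)).1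
          ((_root_.sampleStep s q.1 (⟪q.1, v⟫ + q.2)).2 - θ)‖ ^ 2 ∂(sampleLaw E σ) =
        (1 - 1 / (d : ℝ)) * ‖s.1 (s.2 - θ)‖ ^ 2 := by
  simp_rw [sampleStep_fst_apply_snd_sub hs]
  exact hs.integral_norm_sq_sampleStep_fst_apply hd σ v (s.2 - θ)

lemma IsOrthProj.ae_sampleStep {d : ℕ} {s : (E →L[ℝ] E) × E} (hs : IsOrthProj (d + 1) s.1)
    (σ : ℝ≥0) : ∀ᵐ q ∂(sampleLaw E σ), s.1 q.1 ≠ 0 :=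
  Measure.quasiMeasurePreserving_fst.ae (hs.ae_apply_ne_zero d.succ_pos)

end Step

/-! ### Fitting a block sample by sample yields the nearest interpolant. -/

section Fold

variable {E : Type*} [NormedAddCommGroup E] [InnerProductSpace ℝ E]

/-- State after fitting the samples of a block one after the other, started at `w`. -/
noncomputable def sampleFold (w : E) (L : List (E × ℝ)) : (E →L[ℝ] E) × E :=
  L.foldl (fun s q => sampleStep s q.1 q.2) (ContinuousLinearMap.id ℝ E, w)

lemma sampleFold_concat (w : E) (L : List (E × ℝ)) (q : E × ℝ) :
    sampleFold w (L ++ [q]) = sampleStep (sampleFold w L) q.1 q.2 := by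
  simp [sampleFold]

/-- No feature vector of the block lies in the span of the previous ones. -/
def SampleNondegenerate (w : E) (L : List (E × ℝ)) : Prop :=
  ∀ L' q, L' ++ [q] <+: L → (sampleFold w L').1 q.1 ≠ 0

lemma sampleNondegenerate_concat {w : E} {L : List (E × ℝ)} {q : E × ℝ} :
    SampleNondegenerate w (L ++ [q]) ↔
      SampleNondegenerate w L ∧ (sampleFold w L).1 q.1 ≠ 0 := by
  constructor
  · intro h
    exact ⟨fun L' q' hp => h L' q' (hp.trans (List.prefix_append _ _)), h L q (List.prefix_refl _)⟩
  · rintro ⟨h1, h2⟩ L' q' hp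
    rcases List.prefix_concat_iff.1 hp with h | h
    · obtain ⟨rfl, hq⟩ := List.append_inj' h rfl
      obtain rfl : q' = q := by simpa using hq
      exact h2
    · exact h1 _ _ h

variable [FiniteDimensional ℝ E]

lemma SampleNondegenerate.isOrthProj {w : E} {L : List (E × ℝ)} (hL : SampleNondegenerate w L)
    {d : ℕ} (hd : L.length + d = Module.finrank ℝ E) : IsOrthProj d (sampleFold w L).1 := by
  induction L using List.reverseRecOn generalizing d with
  | nil =>
    simp only [List.length_nil, zero_add] at hd
    rw [hd]
    exact IsOrthProj.id
  | append_singleton L q ih =>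
    rw [sampleNondegenerate_concat] at hL
    rw [sampleFold_concat]
    refine (ih hL.1 ?_).sampleStep hL.2 _
    simp only [List.length_append, List.length_singleton] at hd
    omega

/-- The claims support each other. A step moves w along Qx, which is orthogonal to the earlier
features because Q kills them, so earlier samples stay fitted. A vector u orthogonal to all features
is fixed by Q, so ⟨Qx, u⟩ = ⟨x, u⟩ = 0. The last claim says that the total displacement is
orthogonal to the directions of the constraint space, which characterizes the nearest point. -/
lemma SampleNondegenerate.spec {w : E} {L : List (E × ℝ)} (hL : SampleNondegenerate w L)
    (hd : L.length ≤ Module.finrank ℝ E) :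
    (∀ q ∈ L, (sampleFold w L).1 q.1 = 0) ∧
    (∀ q ∈ L, ⟪q.1, (sampleFold w L).2⟫ = q.2) ∧
    ∀ u, (∀ q ∈ L, ⟪q.1, u⟫ = 0) →
      (sampleFold w L).1 u = u ∧ ⟪u, (sampleFold w L).2 - w⟫ = 0 := by
  induction L using List.reverseRecOn with
  | nil => simp [sampleFold]
  | append_singleton L q ih =>
    rw [sampleNondegenerate_concat] at hL
    have hlen : L.length ≤ Module.finrank ℝ E := by
      simp only [List.length_append, List.length_singleton] at hd
      omega
    obtain ⟨h1, h2, h3⟩ := ih hL.1 hlen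
    have hQ := hL.1.isOrthProj (Nat.add_sub_of_le hlen)
    have hr : ‖(sampleFold w L).1 q.1‖ ^ 2 ≠ 0 := by simpa using hL.2
    rw [sampleFold_concat]
    refine ⟨?_, ?_, ?_⟩
    · intro q' hq'
      rw [sampleStep_fst_apply]
      rcases List.mem_append.1 hq' with h | h
      · rw [hQ.symm, h1 q' h]; simp
      · obtain rfl : q' = q := by simpa using h
        rw [hQ.symm, ← hQ.inner_apply_apply, real_inner_self_eq_norm_sq, div_self hr, one_smul,
          sub_self]
    · intro q' hq'
      rw [sampleStep_snd, inner_add_right, real_inner_smul_right]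
      rcases List.mem_append.1 hq' with h | h
      · rw [← hQ.symm, h1 q' h, h2 q' h]; simp
      · obtain rfl : q' = q := by simpa using h
        rw [← hQ.inner_apply_apply, real_inner_self_eq_norm_sq, div_mul_cancel₀ _ hr]
        ring
    · intro u hu
      obtain ⟨h4, h5⟩ := h3 u fun q' hq' => hu q' (List.mem_append_left _ hq')
      have h6 : ⟪q.1, u⟫ = 0 := hu q (by simp)
      have h7 : ⟪(sampleFold w L).1 q.1, u⟫ = 0 := by rw [hQ.symm, h4, h6]
      refine ⟨?_, ?_⟩
      · rw [sampleStep_fst_apply, h4, h7]; simp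
      · rw [sampleStep_snd, add_sub_right_comm, inner_add_right, h5, real_inner_smul_right,
          real_inner_comm ((sampleFold w L).1 q.1) u, h7]; simp

end Fold

/-- By Pythagoras w is the unique minimizer, hence it is the one picked by choice. -/
lemma nearestPoint_eq {p : ℕ} {w₀ w : EuclideanSpace ℝ (Fin p)}
    {C : Set (EuclideanSpace ℝ (Fin p))} (hw : w ∈ C) (h : ∀ v ∈ C, ⟪v - w, w - w₀⟫ = 0) :
    nearestPoint w₀ C = w := by
  have key : ∀ v ∈ C, ‖v - w₀‖ ^ 2 = ‖v - w‖ ^ 2 + ‖w - w₀‖ ^ 2 := by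
    intro v hv
    rw [← sub_add_sub_cancel v w w₀, norm_add_sq_real, h v hv]; ring
  have hex : ∃ w ∈ C, IsMinOn (fun v => ‖v - w₀‖ ^ 2) C w := by
    refine ⟨w, hw, fun v hv => ?_⟩
    simp only [Set.mem_ofPred_eq]
    rw [key v hv]
    nlinarith [sq_nonneg ‖v - w‖]
  rw [nearestPoint, dif_pos hex]
  obtain ⟨h1, h2⟩ := hex.choose_spec
  have h3 := h2 hw
  simp only [Set.mem_ofPred_eq] at h3
  rw [key _ h1] at h3
  have h4 : ‖hex.choose - w‖ ^ 2 = 0 := le_antisymm (by linarith) (sq_nonneg _)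
  simpa [sub_eq_zero] using h4

lemma nearestPoint_eq_sampleFold {p : ℕ} {w : EuclideanSpace ℝ (Fin p)}
    {L : List (EuclideanSpace ℝ (Fin p) × ℝ)} (hL : SampleNondegenerate w L) (hp : L.length ≤ p) :
    nearestPoint w {v | ∀ q ∈ L, ⟪q.1, v⟫ = q.2} = (sampleFold w L).2 := by
  obtain ⟨-, h2, h3⟩ := hL.spec (by simpa using hp)
  refine nearestPoint_eq h2 fun v hv => (h3 _ fun q hq => ?_).2
  rw [inner_sub_right, hv q hq, h2 q hq, sub_self]

/-- Half the sum of the squared distances over all ordered pairs of entries of a list. -/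
noncomputable def pairDist {E : Type*} [NormedAddCommGroup E] (l : List E) : ℝ :=
  (l.map fun a => (l.map fun b => ‖a - b‖ ^ 2).sum).sum / 2

lemma pairDist_concat {E : Type*} [NormedAddCommGroup E] (l : List E) (v : E) :
    pairDist (l ++ [v]) = pairDist l + (l.map fun a => ‖a - v‖ ^ 2).sum := by
  simp only [pairDist, List.map_append, List.sum_append, List.map_cons, List.map_nil,
    List.sum_cons, List.sum_nil, List.sum_map_add, sub_self, norm_zero]
  simp_rw [norm_sub_rev v]
  simp
  ring

/-! ### Independent samples and the expected error of a block. -/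

section Random

variable {E : Type*} [NormedAddCommGroup E] [InnerProductSpace ℝ E] [FiniteDimensional ℝ E]
  [MeasurableSpace E] [BorelSpace E]
variable {Ω κ : Type*}

/-- The σ-algebra generated by the samples with index in `A`. -/
@[reducible]
def sampleSigma (ξ : κ → Ω → E × ℝ) (A : Set κ) : MeasurableSpace Ω :=
  ⨆ a ∈ A, MeasurableSpace.comap (ξ a) inferInstance

omit [NormedAddCommGroup E] [InnerProductSpace ℝ E] [FiniteDimensional ℝ E] [BorelSpace E] in
lemma sampleSigma_mono (ξ : κ → Ω → E × ℝ) {A B : Set κ} (h : A ⊆ B) :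
    sampleSigma ξ A ≤ sampleSigma ξ B :=
  biSup_mono h

omit [NormedAddCommGroup E] [InnerProductSpace ℝ E] [FiniteDimensional ℝ E] [BorelSpace E] in
lemma measurable_sampleSigma (ξ : κ → Ω → E × ℝ) {A : Set κ} {a : κ} (ha : a ∈ A) :
    Measurable[sampleSigma ξ A] (ξ a) :=
  (comap_measurable (ξ a)).mono
    (le_biSup (fun a => MeasurableSpace.comap (ξ a) inferInstance) ha) le_rfl

variable [MeasurableSpace Ω]

/-- The samples `ξ s`, `s ∈ V`, are measurable, independent, and have law `sampleLaw E σ`. -/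
structure IndepSamples (μ : Measure Ω) (V : Set κ) (σ : ℝ≥0) (ξ : κ → Ω → E × ℝ) : Prop where
  meas : ∀ s, Measurable (ξ s)
  law : ∀ s ∈ V, μ.map (ξ s) = sampleLaw E σ
  indep : ∀ s ∈ V, ∀ A ⊆ V, s ∉ A →
    Indep (sampleSigma ξ A) (MeasurableSpace.comap (ξ s) inferInstance) μ

variable {μ : Measure Ω} [IsProbabilityMeasure μ] {V : Set κ} {σ : ℝ≥0} {ξ : κ → Ω → E × ℝ}
variable {β : Type*} [MeasurableSpace β]

omit [BorelSpace E] [IsProbabilityMeasure μ] in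
lemma IndepSamples.sampleSigma_le (hξ : IndepSamples μ V σ ξ) (A : Set κ) :
    sampleSigma ξ A ≤ ‹MeasurableSpace Ω› :=
  iSup₂_le fun a _ => (hξ.meas a).comap_le

omit [BorelSpace E] in
lemma IndepSamples.map_prod (hξ : IndepSamples μ V σ ξ) {A : Set κ} (hA : A ⊆ V) {s : κ}
    (hs : s ∈ V) (hsA : s ∉ A) {S : Ω → β} (hS : Measurable[sampleSigma ξ A] S) :
    μ.map (fun ω => (S ω, ξ s ω)) = (μ.map S).prod (sampleLaw E σ) := by
  have hSm : Measurable S := hS.mono (hξ.sampleSigma_le A) le_rfl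
  have hind : IndepFun S (ξ s) μ :=
    indep_of_indep_of_le_left (hξ.indep s hs A hA hsA) hS.comap_le
  rw [(indepFun_iff_map_prod_eq_prod_map_map hSm.aemeasurable (hξ.meas s).aemeasurable).1 hind,
    hξ.law s hs]

/-- The state S is a function of earlier samples, hence independent of the fresh one, and Fubini
allows the fresh sample to be integrated out with S frozen. As f is nonnegative, integrability of g
∘ S yields that of f. -/
lemma IndepSamples.integral_step (hξ : IndepSamples μ V σ ξ) {A : Set κ} (hA : A ⊆ V) {s : κ}
    (hs : s ∈ V) (hsA : s ∉ A) {S : Ω → β} (hS : Measurable[sampleSigma ξ A] S)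
    {f : β × (E × ℝ) → ℝ} (hf : Measurable f) (hf0 : ∀ q, 0 ≤ f q) {g : β → ℝ}
    (hfg : ∀ᵐ ω ∂μ, Integrable (fun q => f (S ω, q)) (sampleLaw E σ) ∧
      ∫ q, f (S ω, q) ∂(sampleLaw E σ) = g (S ω))
    (hg : Integrable (fun ω => g (S ω)) μ) :
    Integrable (fun ω => f (S ω, ξ s ω)) μ ∧ ∫ ω, f (S ω, ξ s ω) ∂μ = ∫ ω, g (S ω) ∂μ := by
  have hSm : Measurable S := hS.mono (hξ.sampleSigma_le A) le_rfl
  have hmap := hξ.map_prod hA hs hsA hS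
  have hpm : AEMeasurable (fun ω => (S ω, ξ s ω)) μ := (hSm.prodMk (hξ.meas s)).aemeasurable
  have : IsProbabilityMeasure (μ.map S) := Measure.isProbabilityMeasure_map hSm.aemeasurable
  have hgm : Integrable (fun b => ∫ q, f (b, q) ∂(sampleLaw E σ)) (μ.map S) := by
    rw [integrable_map_measure hf.stronglyMeasurable.integral_prod_right'.aestronglyMeasurable
      hSm.aemeasurable]
    refine hg.congr ?_
    filter_upwards [hfg] with ω hω using hω.2.symm
  have hint : Integrable f ((μ.map S).prod (sampleLaw E σ)) := by
    rw [integrable_prod_iff hf.aestronglyMeasurable]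
    constructor
    · rw [ae_map_iff hSm.aemeasurable]
      · filter_upwards [hfg] with ω hω using hω.1
      · exact measurableSet_integrable hf.stronglyMeasurable
    · refine hgm.congr (Filter.Eventually.of_forall fun b => ?_)
      simp_rw [Real.norm_of_nonneg (hf0 _)]
  constructor
  · rw [← hmap] at hint
    exact (integrable_map_measure hf.aestronglyMeasurable hpm).1 hint
  · rw [← integral_map hpm hf.aestronglyMeasurable, hmap, integral_prod _ hint,
      integral_map hSm.aemeasurable hgm.aestronglyMeasurable]
    refine integral_congr_ae ?_
    filter_upwards [hfg] with ω hω using hω.2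

/-- The same freezing argument for null sets; it shows that a fresh feature is almost surely not in
the span of the earlier ones. -/
lemma IndepSamples.ae_step (hξ : IndepSamples μ V σ ξ) {A : Set κ} (hA : A ⊆ V) {s : κ}
    (hs : s ∈ V) (hsA : s ∉ A) {S : Ω → β} (hS : Measurable[sampleSigma ξ A] S)
    {P : β × (E × ℝ) → Prop} (hP : MeasurableSet {q | P q})
    (h : ∀ᵐ ω ∂μ, ∀ᵐ q ∂(sampleLaw E σ), P (S ω, q)) :
    ∀ᵐ ω ∂μ, P (S ω, ξ s ω) := by
  have hSm : Measurable S := hS.mono (hξ.sampleSigma_le A) le_rfl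
  have hpm : AEMeasurable (fun ω => (S ω, ξ s ω)) μ := (hSm.prodMk (hξ.meas s)).aemeasurable
  have : IsProbabilityMeasure (μ.map S) := Measure.isProbabilityMeasure_map hSm.aemeasurable
  have h1 : ∀ᵐ q ∂((μ.map S).prod (sampleLaw E σ)), P q := by
    rw [Measure.ae_prod_iff_ae_ae hP, ae_map_iff hSm.aemeasurable]
    · exact h
    · exact measurable_measure_prodMk_left hP.compl (measurableSet_singleton 0)
  rw [← hξ.map_prod hA hs hsA hS, ae_map_iff hpm hP] at h1
  exact h1

/-- The samples of a block, in the form (feature vector, output), where sample `s` is generated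
from the ground truth `v s`. -/
def blockData (ξ : κ → Ω → E × ℝ) (v : κ → E) (L : List κ) (ω : Ω) : List (E × ℝ) :=
  L.map fun s => ((ξ s ω).1, ⟪(ξ s ω).1, v s⟫ + (ξ s ω).2)

omit [FiniteDimensional ℝ E] [MeasurableSpace E] [BorelSpace E] [MeasurableSpace Ω] in
lemma sampleFold_blockData_concat (ξ : κ → Ω → E × ℝ) (v : κ → E) (L : List κ) (s : κ) (w : E)
    (ω : Ω) : sampleFold w (blockData ξ v (L ++ [s]) ω) =
      sampleStep (sampleFold w (blockData ξ v L ω)) (ξ s ω).1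
        (⟪(ξ s ω).1, v s⟫ + (ξ s ω).2) := by
  rw [blockData, List.map_append, List.map_cons, List.map_nil, sampleFold_concat]; rfl

omit [MeasurableSpace Ω] in
lemma measurable_sampleFold_blockData (ξ : κ → Ω → E × ℝ) (v : κ → E) {A : Set κ} {W : Ω → E}
    (hW : Measurable[sampleSigma ξ A] W) (L : List κ) :
    Measurable[sampleSigma ξ (A ∪ {s | s ∈ L})]
      fun ω => sampleFold (W ω) (blockData ξ v L ω) := by
  induction L using List.reverseRecOn with
  | nil =>
    refine Measurable.prodMk measurable_const (hW.mono (sampleSigma_mono ξ ?_) le_rfl)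
    exact Set.subset_union_left
  | append_singleton L s ih =>
    simp_rw [sampleFold_blockData_concat]
    have h1 := ih.mono (sampleSigma_mono ξ (B := A ∪ {t | t ∈ L ++ [s]}) (by
      intro t ht; simp only [Set.mem_union, Set.mem_ofPred_eq, List.mem_append] at ht ⊢; tauto)) le_rfl
    have h2 : Measurable[sampleSigma ξ (A ∪ {t | t ∈ L ++ [s]})] (ξ s) :=
      measurable_sampleSigma ξ (by simp)
    have h3 : Measurable fun q : ((E →L[ℝ] E) × E) × (E × ℝ) =>
        sampleStep q.1 q.2.1 (⟪q.2.1, v s⟫ + q.2.2) :=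
      measurable_sampleStep.comp (measurable_fst.prodMk
        ((by fun_prop : Measurable fun q : ((E →L[ℝ] E) × E) × (E × ℝ) =>
          (q.2.1, ⟪q.2.1, v s⟫ + q.2.2))))
    exact h3.comp (h1.prodMk h2)

/-- Expected errors after fitting a block of samples. -/
theorem IndepSamples.block (hξ : IndepSamples μ V σ ξ) (v : κ → E) {A : Set κ} (hA : A ⊆ V)
    {W : Ω → E} (hW : Measurable[sampleSigma ξ A] W)
    (hint : ∀ θ, Integrable (fun ω => ‖W ω - θ‖ ^ 2) μ)
    (L : List κ) (hnd : L.Nodup) (hLV : ∀ s ∈ L, s ∈ V) (hLA : ∀ s ∈ L, s ∉ A)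
    (hlen : L.length + 2 ≤ Module.finrank ℝ E) :
    (∀ᵐ ω ∂μ, SampleNondegenerate (W ω) (blockData ξ v L ω)) ∧
    (∀ u, Integrable (fun ω => ‖(sampleFold (W ω) (blockData ξ v L ω)).1 u‖ ^ 2) μ ∧
      ∫ ω, ‖(sampleFold (W ω) (blockData ξ v L ω)).1 u‖ ^ 2 ∂μ =
        (1 - L.length / (Module.finrank ℝ E : ℝ)) * ‖u‖ ^ 2) ∧
    (∀ θ, Integrable (fun ω => ‖(sampleFold (W ω) (blockData ξ v L ω)).1
        ((sampleFold (W ω) (blockData ξ v L ω)).2 - θ)‖ ^ 2) μ ∧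
      ∫ ω, ‖(sampleFold (W ω) (blockData ξ v L ω)).1
        ((sampleFold (W ω) (blockData ξ v L ω)).2 - θ)‖ ^ 2 ∂μ =
        (1 - L.length / (Module.finrank ℝ E : ℝ)) * ∫ ω, ‖W ω - θ‖ ^ 2 ∂μ) ∧
    (∀ θ, Integrable (fun ω => ‖(sampleFold (W ω) (blockData ξ v L ω)).2 - θ‖ ^ 2) μ ∧
      ∫ ω, ‖(sampleFold (W ω) (blockData ξ v L ω)).2 - θ‖ ^ 2 ∂μ =
        (1 - L.length / (Module.finrank ℝ E : ℝ)) * ∫ ω, ‖W ω - θ‖ ^ 2 ∂μ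
        + 1 / (Module.finrank ℝ E : ℝ) * ((L.map fun s => ‖v s - θ‖ ^ 2).sum
            + pairDist (L.map v) / ((Module.finrank ℝ E : ℝ) - L.length - 1))
        + L.length * (σ : ℝ) ^ 2 / ((Module.finrank ℝ E : ℝ) - L.length - 1)) := by
  induction L using List.reverseRecOn with
  | nil =>
    refine ⟨Filter.Eventually.of_forall fun ω L' q h => by simp [blockData] at h, fun u => ?_,
      fun θ => ?_, fun θ => ?_⟩
    · simp [sampleFold, blockData]
    · simpa [sampleFold, blockData] using hint θ
    · simpa [sampleFold, blockData, pairDist] using hint θ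
  | append_singleton L s ih =>
    have hnd' := List.nodup_append.1 hnd
    simp only [List.length_append, List.length_singleton] at hlen
    obtain ⟨h1, h2, h3, h4⟩ := ih hnd'.1 (fun t ht => hLV t (by simp [ht]))
      (fun t ht => hLA t (by simp [ht])) (by omega)
    have hsV : s ∈ V := hLV s (by simp)
    have hsA : s ∉ A ∪ {t | t ∈ L} := by
      rintro (h | h)
      · exact hLA s (by simp) h
      · exact hnd'.2.2 s h s (by simp) rfl
    have hAV : A ∪ {t | t ∈ L} ⊆ V :=
      Set.union_subset hA fun t ht => hLV t (List.mem_append_left _ ht)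
    have hSm := measurable_sampleFold_blockData ξ v hW L
    -- The projection that meets the last sample has rank d + 3; `hlen` guarantees rank at least 3,
    -- so that 1/(rank - 2) is a finite moment.
    obtain ⟨d, hd⟩ : ∃ d, L.length + (d + 3) = Module.finrank ℝ E :=
      ⟨Module.finrank ℝ E - L.length - 3, by omega⟩
    have hproj : ∀ᵐ ω ∂μ, IsOrthProj (d + 3) (sampleFold (W ω) (blockData ξ v L ω)).1 := by
      filter_upwards [h1] with ω hω using hω.isOrthProj (by simpa [blockData] using hd)
    have h3d : 3 ≤ d + 3 := by omega
    have hmeas : Measurable fun q : ((E →L[ℝ] E) × E) × (E × ℝ) =>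
        sampleStep q.1 q.2.1 (⟪q.2.1, v s⟫ + q.2.2) :=
      measurable_sampleStep.comp (measurable_fst.prodMk
        ((by fun_prop : Measurable fun q : ((E →L[ℝ] E) × E) × (E × ℝ) =>
          (q.2.1, ⟪q.2.1, v s⟫ + q.2.2))))
    have hdR : (L.length : ℝ) + (d + 3) = (Module.finrank ℝ E : ℝ) := by exact_mod_cast hd
    have hp0 : (0 : ℝ) < L.length + (d + 3) := by positivity
    have hd2 : (0 : ℝ) < (d : ℝ) + 1 := by positivity
    have hd3 : (0 : ℝ) < (d : ℝ) + 2 := by positivity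
    have hd4 : (0 : ℝ) < (d : ℝ) + 3 := by positivity
    simp_rw [sampleFold_blockData_concat]
    refine ⟨?_, fun u => ?_, fun θ => ?_, fun θ => ?_⟩
    · have hne := hξ.ae_step hAV hsV hsA hSm (P := fun q => q.1.1 q.2.1 ≠ 0)
        ((measurableSet_eq_fun (f := fun q : ((E →L[ℝ] E) × E) × (E × ℝ) => q.1.1 q.2.1)
          (g := fun _ => 0) (by fun_prop) (by fun_prop)).compl)
        (by filter_upwards [hproj] with ω hω using hω.ae_sampleStep σ)
      filter_upwards [h1, hne] with ω hω hω'
      rw [blockData, List.map_append]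
      exact sampleNondegenerate_concat.2 ⟨hω, hω'⟩
    · have key := hξ.integral_step hAV hsV hsA hSm
        (f := fun q => ‖(sampleStep q.1 q.2.1 (⟪q.2.1, v s⟫ + q.2.2)).1 u‖ ^ 2)
        (((by fun_prop : Measurable fun q : (E →L[ℝ] E) × E => ‖q.1 u‖ ^ 2)).comp hmeas) (fun _ => sq_nonneg _)
        (g := fun q => (1 - 1 / ((d + 3 : ℕ) : ℝ)) * ‖q.1 u‖ ^ 2)
        (by filter_upwards [hproj] with ω hω using
              hω.integral_norm_sq_sampleStep_fst_apply h3d σ (v s) u)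
        ((h2 u).1.const_mul _)
      refine ⟨key.1, key.2.trans ?_⟩
      rw [integral_const_mul, (h2 u).2, ← hdR]
      push_cast [List.length_append, List.length_singleton]
      field_simp
      ring
    · have key := hξ.integral_step hAV hsV hsA hSm
        (f := fun q => ‖(sampleStep q.1 q.2.1 (⟪q.2.1, v s⟫ + q.2.2)).1
          ((sampleStep q.1 q.2.1 (⟪q.2.1, v s⟫ + q.2.2)).2 - θ)‖ ^ 2)
        (((by fun_prop : Measurable fun q : (E →L[ℝ] E) × E => ‖q.1 (q.2 - θ)‖ ^ 2)).comp hmeas)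
        (fun _ => sq_nonneg _)
        (g := fun q => (1 - 1 / ((d + 3 : ℕ) : ℝ)) * ‖q.1 (q.2 - θ)‖ ^ 2)
        (by filter_upwards [hproj] with ω hω using
              hω.integral_norm_sq_sampleStep_fst_apply_snd_sub h3d σ (v s) θ)
        ((h3 θ).1.const_mul _)
      refine ⟨key.1, key.2.trans ?_⟩
      rw [integral_const_mul, (h3 θ).2, ← hdR]
      push_cast [List.length_append, List.length_singleton]
      field_simp
      ring
    -- With L earlier samples the rank is p - L and (1 - L/p)/(p - L) = 1/p, so each sample removes
    -- 1/p of the starting error. In `i2` the starting error at `v s` occurs twice with the same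
    -- factor 1 - L/p and cancels, so only the starting error at θ survives.
    · have i1 := ((h2 (v s - θ)).1.sub (h3 θ).1).div_const ((d + 3 : ℕ) : ℝ)
      have i2 := (((h4 (v s)).1.sub (h3 (v s)).1).add (integrable_const ((σ : ℝ) ^ 2))).div_const
        (((d + 3 : ℕ) : ℝ) - 2)
      have i0 := (h4 θ).1
      have key := hξ.integral_step hAV hsV hsA hSm
        (f := fun q => ‖(sampleStep q.1 q.2.1 (⟪q.2.1, v s⟫ + q.2.2)).2 - θ‖ ^ 2)
        (((by fun_prop : Measurable fun q : (E →L[ℝ] E) × E => ‖q.2 - θ‖ ^ 2)).comp hmeas)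
        (fun _ => sq_nonneg _)
        (g := fun q => ‖q.2 - θ‖ ^ 2 + (‖q.1 (v s - θ)‖ ^ 2 - ‖q.1 (q.2 - θ)‖ ^ 2) /
            ((d + 3 : ℕ) : ℝ) + (‖q.2 - v s‖ ^ 2 - ‖q.1 (q.2 - v s)‖ ^ 2 + (σ : ℝ) ^ 2) /
            (((d + 3 : ℕ) : ℝ) - 2))
        (by filter_upwards [hproj] with ω hω using
              hω.integral_norm_sq_sampleStep_snd_sub h3d σ (v s) θ)
        ((i0.add i1).add i2)
      refine ⟨key.1, key.2.trans ?_⟩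
      have e1 := integral_add (i0.add i1) i2
      have e2 := integral_add i0 i1
      simp only [Pi.add_apply, Pi.sub_apply] at e1 e2
      rw [e1, e2, integral_div, integral_div, integral_sub (h2 (v s - θ)).1 (h3 θ).1]
      have e3 := integral_add ((h4 (v s)).1.sub (h3 (v s)).1) (integrable_const (μ := μ) ((σ : ℝ) ^ 2))
      simp only [Pi.sub_apply] at e3
      rw [e3, integral_sub (h4 (v s)).1 (h3 (v s)).1, (h4 θ).2, (h4 (v s)).2, (h3 θ).2,
        (h3 (v s)).2, (h2 (v s - θ)).2]
      simp only [integral_const, probReal_univ, one_smul, List.map_append, List.map_cons,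
        List.map_nil, pairDist_concat, List.sum_append, List.sum_cons, List.sum_nil, add_zero,
        List.length_append, List.length_singleton, List.map_map, Function.comp_def]
      rw [← hdR]
      push_cast
      have a1 : (L.length : ℝ) + (d + 3) - L.length - 1 = d + 2 := by ring
      have a2 : (L.length : ℝ) + (d + 3) - (L.length + 1) - 1 = d + 1 := by ring
      have a3 : (d : ℝ) + 3 - 2 = d + 1 := by ring
      rw [a1, a2, a3]
      field_simp
      ring

end Random

/-! ### From independent coordinates to independent samples. -/

section Data

variable {Ω : Type*} [MeasurableSpace Ω] {μ : Measure Ω} [IsProbabilityMeasure μ]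
variable {p T n M : ℕ} {σ : ℝ≥0}

/-- The indices of the samples used up to time `T`. -/
def validIndex (T n M : ℕ) : Set (ℕ × ℕ × ℕ) :=
  {s | 1 ≤ s.1 ∧ s.1 ≤ T ∧ 1 ≤ s.2.1 ∧ s.2.1 ≤ s.1 ∧ s.2.2 < sampleCount n M s.1 s.2.1}

section Coordinates

variable {κ : Type*} {V : Set κ}

open Classical in
/-- The sample with index `s ∈ V`, assembled from its coordinates and its noise. -/
noncomputable def sampleOfCoords (η : (V × Fin p) ⊕ V → Ω → ℝ) (s : κ) (ω : Ω) :
    EuclideanSpace ℝ (Fin p) × ℝ :=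
  if hs : s ∈ V then
    (WithLp.toLp 2 fun c => η (Sum.inl (⟨s, hs⟩, c)) ω, η (Sum.inr ⟨s, hs⟩) ω) else 0

/-- The index of the sample to which a coordinate or a noise variable belongs. -/
def coordIndex : (V × Fin p) ⊕ V → κ := Sum.elim (fun q => q.1.1) (fun s => s.1)

/-- The σ-algebra generated by the real variables with index in `S`. -/
@[reducible]
def coordSigma {I : Type*} (η : I → Ω → ℝ) (S : Set I) : MeasurableSpace Ω :=
  ⨆ i ∈ S, MeasurableSpace.comap (η i) inferInstance

omit [MeasurableSpace Ω] in
lemma measurable_coordSigma {I : Type*} (η : I → Ω → ℝ) {S : Set I} {i : I} (hi : i ∈ S) :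
    Measurable[coordSigma η S] (η i) :=
  (comap_measurable (η i)).mono
    (le_biSup (fun i => MeasurableSpace.comap (η i) inferInstance) hi) le_rfl

omit [MeasurableSpace Ω] in
lemma measurable_coordSigma_toLp {I : Type*} (η : I → Ω → ℝ) {S : Set I} {g : Fin p → I}
    (hg : ∀ c, g c ∈ S) :
    Measurable[coordSigma η S]
      fun ω => (WithLp.toLp 2 fun c => η (g c) ω : EuclideanSpace ℝ (Fin p)) := by
  have h1 : Measurable (WithLp.toLp 2 : (Fin p → ℝ) → EuclideanSpace ℝ (Fin p)) := by fun_prop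
  refine h1.comp ?_
  exact (@measurable_pi_iff _ _ _ (coordSigma η S) _ _).2 fun c => measurable_coordSigma η (hg c)

omit [MeasurableSpace Ω] in
lemma measurable_sampleOfCoords (η : (V × Fin p) ⊕ V → Ω → ℝ) {S : Set ((V × Fin p) ⊕ V)} {s : κ}
    (hS : ∀ i, coordIndex i = s → i ∈ S) : Measurable[coordSigma η S] (sampleOfCoords η s) := by
  by_cases hs : s ∈ V
  · have h1 : sampleOfCoords η s = fun ω =>
        (WithLp.toLp 2 fun c => η (Sum.inl (⟨s, hs⟩, c)) ω, η (Sum.inr ⟨s, hs⟩) ω) := by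
      funext ω; simp only [sampleOfCoords, hs, dif_pos]
    rw [h1]
    exact (measurable_coordSigma_toLp η (g := fun c => Sum.inl (⟨s, hs⟩, c))
      fun c => hS _ rfl).prodMk (measurable_coordSigma η (hS _ rfl))
  · have h1 : sampleOfCoords η s = fun _ => 0 := by
      funext ω; simp only [sampleOfCoords, hs, dif_neg, not_false_eq_true]
    rw [h1]
    exact measurable_const

/-- Disjoint groups of the real variables generate independent σ-algebras. This separates the
feature from the noise within one sample, and one sample from all others. -/
theorem indepSamples_sampleOfCoords {η : (V × Fin p) ⊕ V → Ω → ℝ} (hm : ∀ i, Measurable (η i))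
    (hind : iIndepFun η μ) (hx : ∀ q, μ.map (η (Sum.inl q)) = gaussianReal 0 1)
    (hz : ∀ s, μ.map (η (Sum.inr s)) = gaussianReal 0 (σ ^ 2)) :
    IndepSamples μ V σ (sampleOfCoords η) := by
  have hdisj : ∀ S S', Disjoint S S' → Indep (coordSigma η S) (coordSigma η S') μ :=
    fun S S' hSS => indep_iSup_of_disjoint (fun i => (hm i).comap_le) hind hSS
  have hle : ∀ S, coordSigma η S ≤ ‹MeasurableSpace Ω› :=
    fun S => iSup₂_le fun i _ => (hm i).comap_le
  refine ⟨fun s => (measurable_sampleOfCoords η (S := Set.univ) fun _ _ => Set.mem_univ _).mono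
    (hle _) le_rfl, fun s hs => ?_, fun s hs A _ hsA => ?_⟩
  · have h0 := measurable_coordSigma_toLp η (g := fun c => Sum.inl (⟨s, hs⟩, c))
      (S := Set.range fun c => Sum.inl (⟨s, hs⟩, c)) fun c => ⟨c, rfl⟩
    have h2 : IndepFun (fun ω => (WithLp.toLp 2 fun c => η (Sum.inl (⟨s, hs⟩, c)) ω :
        EuclideanSpace ℝ (Fin p))) (η (Sum.inr ⟨s, hs⟩)) μ := by
      have h3 := hdisj (Set.range fun c => Sum.inl (⟨s, hs⟩, c)) {Sum.inr ⟨s, hs⟩} (by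
        rw [Set.disjoint_singleton_right]; rintro ⟨c, hc⟩; simp at hc)
      exact indep_of_indep_of_le_left (indep_of_indep_of_le_right h3
        (measurable_coordSigma η (Set.mem_singleton _)).comap_le) h0.comap_le
    have h4 : sampleOfCoords η s = fun ω =>
        (WithLp.toLp 2 fun c => η (Sum.inl (⟨s, hs⟩, c)) ω, η (Sum.inr ⟨s, hs⟩) ω) := by
      funext ω; simp only [sampleOfCoords, hs, dif_pos]
    have h5 : μ.map (fun ω => (WithLp.toLp 2 fun c => η (Sum.inl (⟨s, hs⟩, c)) ω :
        EuclideanSpace ℝ (Fin p))) = stdGaussian (EuclideanSpace ℝ (Fin p)) := by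
      have h6 : iIndepFun (fun c : Fin p => η (Sum.inl (⟨s, hs⟩, c))) μ :=
        hind.precomp (g := fun c => Sum.inl (⟨s, hs⟩, c)) fun c c' hc => by simpa using hc
      have h7 := h6.map_fun_eq_pi_map fun c => (hm _).aemeasurable
      simp_rw [hx] at h7
      rw [← map_pi_eq_stdGaussian, ← h7, Measure.map_map (by fun_prop)
        (measurable_pi_lambda _ fun c => hm _)]
      rfl
    rw [h4, (indepFun_iff_map_prod_eq_prod_map_map (h0.mono (hle _) le_rfl).aemeasurable
      (hm _).aemeasurable).1 h2, h5, hz]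
    rfl
  · have h3 := hdisj (coordIndex ⁻¹' A) (coordIndex ⁻¹' {s}) (by
      rw [Set.disjoint_left]; rintro i hi hi'
      exact hsA (by rw [← Set.mem_singleton_iff.1 hi']; exact hi))
    refine indep_of_indep_of_le_left (indep_of_indep_of_le_right h3
      (measurable_sampleOfCoords η fun i hi => hi).comap_le) (iSup₂_le fun a ha => ?_)
    exact (measurable_sampleOfCoords η fun i hi => by rw [Set.mem_preimage, hi]; exact ha).comap_le

end Coordinates

/-- `HasLaw` gives measurability only almost everywhere, so the variables are replaced by measurable
modifications; there are countably many, hence one null set suffices. -/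
theorem GaussianData.exists_indepSamples {x : ℕ → ℕ → ℕ → Ω → EuclideanSpace ℝ (Fin p)}
    {z : ℕ → ℕ → ℕ → Ω → ℝ} (h : GaussianData μ T n M σ x z) :
    ∃ ξ : ℕ × ℕ × ℕ → Ω → EuclideanSpace ℝ (Fin p) × ℝ,
      IndepSamples μ (validIndex T n M) σ ξ ∧
      ∀ᵐ ω ∂μ, ∀ s ∈ validIndex T n M, ξ s ω = (x s.1 s.2.1 s.2.2 ω, z s.1 s.2.1 s.2.2 ω) := by
  let η : (validIndex T n M × Fin p) ⊕ validIndex T n M → Ω → ℝ := Sum.elim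
      (fun q ω => x q.1.1.1 q.1.1.2.1 q.1.1.2.2 ω q.2)
      (fun s ω => z s.1.1 s.1.2.1 s.1.2.2 ω)
  have hη : ∀ i, AEMeasurable (η i) μ := by
    rintro (⟨s, c⟩ | s)
    · exact (h.feature_law s c).aemeasurable
    · exact (h.noise_law s).aemeasurable
  have heq : ∀ i, η i =ᵐ[μ] (hη i).mk := fun i => (hη i).ae_eq_mk
  have hind : iIndepFun η μ := h.indep
  refine ⟨sampleOfCoords fun i => (hη i).mk, indepSamples_sampleOfCoords
    (fun i => (hη i).measurable_mk) (hind.congr heq) (fun q => ?_) (fun s => ?_), ?_⟩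
  · rw [← Measure.map_congr (heq _)]
    exact (h.feature_law q.1 q.2).map_eq
  · rw [← Measure.map_congr (heq _)]
    exact (h.noise_law s).map_eq
  · have h1 : ∀ᵐ ω ∂μ, ∀ i, η i ω = (hη i).mk _ ω := ae_all_iff.2 heq
    filter_upwards [h1] with ω hω s hs
    simp only [sampleOfCoords, hs, dif_pos]
    refine Prod.ext ?_ ?_
    · ext c
      exact (hω (Sum.inl (⟨s, hs⟩, c))).symm
    · exact (hω (Sum.inr ⟨s, hs⟩)).symm

end Data

/-! ### Expected error after one projection. -/

section Fitted

variable {Ω κ : Type*} [MeasurableSpace Ω] {μ : Measure Ω} [IsProbabilityMeasure μ] {p : ℕ}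
variable {V : Set κ} {σ : ℝ≥0} {ξ : κ → Ω → EuclideanSpace ℝ (Fin p) × ℝ}

/-- Up to null sets, the random vector `R` is a function of the samples in `A`, and `e θ` is the
expected squared distance of `R` to `θ`. -/
structure HasExpectedError (μ : Measure Ω) (ξ : κ → Ω → EuclideanSpace ℝ (Fin p) × ℝ) (A : Set κ)
    (R : Ω → EuclideanSpace ℝ (Fin p)) (e : EuclideanSpace ℝ (Fin p) → ℝ) : Prop where
  exists_measurable : ∃ W, Measurable[sampleSigma ξ A] W ∧ R =ᵐ[μ] W
  integrable : ∀ θ, Integrable (fun ω => ‖R ω - θ‖ ^ 2) μ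
  integral_eq : ∀ θ, ∫ ω, ‖R ω - θ‖ ^ 2 ∂μ = e θ

/-- Since `nearestPoint` rests on a choice, R is replaced by its measurable version W,
`IndepSamples.block` is applied to W, and the result is carried back along almost sure equality. -/
theorem HasExpectedError.nearestPoint (hξ : IndepSamples μ V σ ξ) {A : Set κ} (hA : A ⊆ V)
    {R : Ω → EuclideanSpace ℝ (Fin p)} {e : EuclideanSpace ℝ (Fin p) → ℝ}
    (hR : HasExpectedError μ ξ A R e) (v : κ → EuclideanSpace ℝ (Fin p)) {L : List κ}
    (hnd : L.Nodup) (hLV : ∀ s ∈ L, s ∈ V) (hLA : ∀ s ∈ L, s ∉ A) (hlen : L.length + 2 ≤ p)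
    {C : Ω → Set (EuclideanSpace ℝ (Fin p))}
    (hC : ∀ᵐ ω ∂μ, C ω = {w | ∀ s ∈ L, ⟪(ξ s ω).1, w⟫ = ⟪(ξ s ω).1, v s⟫ + (ξ s ω).2}) :
    HasExpectedError μ ξ (A ∪ {s | s ∈ L}) (fun ω => nearestPoint (R ω) (C ω)) fun θ =>
      (1 - L.length / (p : ℝ)) * e θ
        + 1 / (p : ℝ) * ((L.map fun s => ‖v s - θ‖ ^ 2).sum
            + pairDist (L.map v) / ((p : ℝ) - L.length - 1))
        + L.length * (σ : ℝ) ^ 2 / ((p : ℝ) - L.length - 1) := by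
  obtain ⟨W, hW, hRW⟩ := hR.exists_measurable
  have hcongr : ∀ θ, (fun ω => ‖R ω - θ‖ ^ 2) =ᵐ[μ] fun ω => ‖W ω - θ‖ ^ 2 := fun θ => by
    filter_upwards [hRW] with ω hω; rw [hω]
  have hfin : Module.finrank ℝ (EuclideanSpace ℝ (Fin p)) = p := by simp
  obtain ⟨h1, -, -, h4⟩ := hξ.block v hA hW (fun θ => (hR.integrable θ).congr (hcongr θ)) L hnd hLV
    hLA (by rwa [hfin])
  have hnp : (fun ω => _root_.nearestPoint (R ω) (C ω)) =ᵐ[μ]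
      fun ω => (sampleFold (W ω) (blockData ξ v L ω)).2 := by
    filter_upwards [hRW, hC, h1] with ω hω1 hω2 hω3
    rw [hω1, hω2, ← nearestPoint_eq_sampleFold hω3 (by simp only [blockData, List.length_map]; omega)]
    simp [blockData]
  have hcongr' : ∀ θ, (fun ω => ‖_root_.nearestPoint (R ω) (C ω) - θ‖ ^ 2) =ᵐ[μ]
      fun ω => ‖(sampleFold (W ω) (blockData ξ v L ω)).2 - θ‖ ^ 2 := fun θ => by
    filter_upwards [hnp] with ω hω; rw [hω]
  refine ⟨⟨_, (measurable_sampleFold_blockData ξ v hW L).snd, hnp⟩,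
    fun θ => (h4 θ).1.congr (hcongr' θ).symm, fun θ => ?_⟩
  rw [integral_congr_ae (hcongr' θ), (h4 θ).2, ← integral_congr_ae (hcongr θ), hR.integral_eq, hfin]

omit [IsProbabilityMeasure μ] in
lemma HasExpectedError.mono {A B : Set κ} (hAB : A ⊆ B) {R : Ω → EuclideanSpace ℝ (Fin p)}
    {e e' : EuclideanSpace ℝ (Fin p) → ℝ} (hR : HasExpectedError μ ξ A R e) (he : ∀ θ, e θ = e' θ) :
    HasExpectedError μ ξ B R e' := by
  obtain ⟨W, hW, hRW⟩ := hR.exists_measurable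
  exact ⟨⟨W, hW.mono (sampleSigma_mono ξ hAB) le_rfl, hRW⟩, hR.integrable,
    fun θ => (hR.integral_eq θ).trans (he θ)⟩

end Fitted

/-! ### Sample indices of the data sets at one time. -/

section Task

variable {p : ℕ}

/-- The indices of the samples in the data set of source task `h` at time `t`. -/
def dataIndex (n M t h : ℕ) : List (ℕ × ℕ × ℕ) :=
  (List.range (sampleCount n M t h)).map fun a => (t, h, a)

lemma mem_dataIndex {n M t h : ℕ} {s : ℕ × ℕ × ℕ} :
    s ∈ dataIndex n M t h ↔ s.1 = t ∧ s.2.1 = h ∧ s.2.2 < sampleCount n M t h := by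
  obtain ⟨a, b, c⟩ := s
  simp only [dataIndex, List.mem_map, List.mem_range, Prod.mk.injEq]
  constructor
  · rintro ⟨d, hd, rfl, rfl, rfl⟩; exact ⟨rfl, rfl, hd⟩
  · rintro ⟨rfl, rfl, hc⟩; exact ⟨c, hc, rfl, rfl, rfl⟩

lemma nodup_dataIndex (n M t h : ℕ) : (dataIndex n M t h).Nodup :=
  List.nodup_range.map fun a b hab => by simpa using hab

lemma length_dataIndex (n M t h : ℕ) : (dataIndex n M t h).length = sampleCount n M t h := by
  simp [dataIndex]

lemma sum_map_dataIndex (n M t h : ℕ) (f : ℕ → ℝ) :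
    ((dataIndex n M t h).map fun s => f s.2.1).sum = sampleCount n M t h * f h := by
  simp [dataIndex, List.map_map, Function.comp_def]

/-- The indices of the samples in the data sets of all source tasks in `l` at time `t`. -/
def jointIndex (n M t : ℕ) (l : List ℕ) : List (ℕ × ℕ × ℕ) := l.flatMap (dataIndex n M t)

lemma mem_jointIndex {n M t : ℕ} {l : List ℕ} {s : ℕ × ℕ × ℕ} :
    s ∈ jointIndex n M t l ↔ s.1 = t ∧ s.2.1 ∈ l ∧ s.2.2 < sampleCount n M t s.2.1 := by
  simp only [jointIndex, List.mem_flatMap, mem_dataIndex]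
  constructor
  · rintro ⟨h, hl, h1, rfl, h2⟩; exact ⟨h1, hl, h2⟩
  · rintro ⟨h1, h2, h3⟩; exact ⟨_, h2, h1, rfl, h3⟩

lemma nodup_jointIndex (n M t : ℕ) {l : List ℕ} (hl : l.Nodup) : (jointIndex n M t l).Nodup := by
  rw [jointIndex, List.nodup_flatMap]
  refine ⟨fun h _ => nodup_dataIndex n M t h, hl.imp fun {a b} hab => ?_⟩
  intro s h1 h2
  exact hab ((mem_dataIndex.1 h1).2.1.symm.trans (mem_dataIndex.1 h2).2.1)

/-- The summand depends only on the source task, so a sum over samples becomes a sum over tasks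
weighted by sample counts. -/
lemma sum_map_jointIndex (n M t : ℕ) (l : List ℕ) (f : ℕ → ℝ) :
    ((jointIndex n M t l).map fun s => f s.2.1).sum =
      (l.map fun h => sampleCount n M t h * f h).sum := by
  induction l with
  | nil => simp [jointIndex]
  | cons h l ih =>
    have : jointIndex n M t (h :: l) = dataIndex n M t h ++ jointIndex n M t l := by
      simp [jointIndex]
    rw [this, List.map_append, List.sum_append, sum_map_dataIndex, ih]
    simp

lemma length_jointIndex (n M t : ℕ) (l : List ℕ) :
    ((jointIndex n M t l).length : ℝ) = (l.map fun h => (sampleCount n M t h : ℝ)).sum := by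
  have := sum_map_jointIndex n M t l fun _ => 1
  simpa using this

lemma pairDist_jointIndex (n M t : ℕ) (l : List ℕ) (w : ℕ → EuclideanSpace ℝ (Fin p)) :
    pairDist ((jointIndex n M t l).map fun s => w s.2.1) =
      (l.map fun h => sampleCount n M t h *
        (l.map fun k => sampleCount n M t k * ‖w h - w k‖ ^ 2).sum).sum / 2 := by
  simp only [pairDist, List.map_map, Function.comp_def]
  congr 1
  rw [← sum_map_jointIndex n M t l fun h =>
    (l.map fun k => sampleCount n M t k * ‖w h - w k‖ ^ 2).sum]
  congr 1
  refine List.map_congr_left fun s _ => ?_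
  exact sum_map_jointIndex n M t l fun k => ‖w s.2.1 - w k‖ ^ 2

end Task

/-! ### Sequential and concurrent training within one task. -/

section TaskStep

variable {Ω : Type*} [MeasurableSpace Ω] {μ : Measure Ω} [IsProbabilityMeasure μ]
variable {p T n M : ℕ} {σ : ℝ≥0} {ξ : ℕ × ℕ × ℕ → Ω → EuclideanSpace ℝ (Fin p) × ℝ}
  {x : ℕ → ℕ → ℕ → Ω → EuclideanSpace ℝ (Fin p)} {z : ℕ → ℕ → ℕ → Ω → ℝ}
  (wstar : ℕ → EuclideanSpace ℝ (Fin p))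

/-- Parameters that fit the random data set of source task `h` at time `t`. -/
abbrev randomInterpolants (n M : ℕ) (wstar : ℕ → EuclideanSpace ℝ (Fin p))
    (x : ℕ → ℕ → ℕ → Ω → EuclideanSpace ℝ (Fin p)) (z : ℕ → ℕ → ℕ → Ω → ℝ) (t h : ℕ) (ω : Ω) :
    Set (EuclideanSpace ℝ (Fin p)) :=
  interpolants n M (fun t h a => x t h a ω) (fun t h a => groundTruthOutput wstar x z t h a ω) t h

omit [MeasurableSpace Ω] in
lemma mem_randomInterpolants_iff {ω : Ω}
    (hω : ∀ s ∈ validIndex T n M, ξ s ω = (x s.1 s.2.1 s.2.2 ω, z s.1 s.2.1 s.2.2 ω)) {t h : ℕ}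
    (ht : t ≤ T) (h1 : 1 ≤ h) (hht : h ≤ t) (w : EuclideanSpace ℝ (Fin p)) :
    w ∈ randomInterpolants n M wstar x z t h ω ↔
      ∀ s ∈ dataIndex n M t h, ⟪(ξ s ω).1, w⟫ = ⟪(ξ s ω).1, wstar s.2.1⟫ + (ξ s ω).2 := by
  have hv : ∀ a < sampleCount n M t h, ξ (t, h, a) ω = (x t h a ω, z t h a ω) := fun a ha =>
    hω (t, h, a) ⟨h1.trans hht, ht, h1, hht, ha⟩
  simp only [randomInterpolants, interpolants, groundTruthOutput, dataIndex, Set.mem_ofPred_eq,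
    List.forall_mem_map, List.mem_range]
  exact forall₂_congr fun a ha => by rw [hv a ha]

lemma sampleCount_self (n M t : ℕ) : sampleCount n M t t = n := if_pos rfl

lemma sampleCount_of_lt {n M t h : ℕ} (hh : h < t) : sampleCount n M t h = M / (t - 1) :=
  if_neg hh.ne

/-- The samples of one data set share their ground truth; this is why sequential rehearsal produces
no pair terms. -/
lemma pairDist_dataIndex (n M t h : ℕ) (w : ℕ → EuclideanSpace ℝ (Fin p)) :
    pairDist ((dataIndex n M t h).map fun s => w s.2.1) = 0 := by
  have := pairDist_jointIndex n M t [h] w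
  simpa [jointIndex] using this

/-- Training on the memory of the tasks in `D`, one after the other. -/
theorem HasExpectedError.sequential (hξ : IndepSamples μ (validIndex T n M) σ ξ)
    (hx : ∀ᵐ ω ∂μ, ∀ s ∈ validIndex T n M, ξ s ω = (x s.1 s.2.1 s.2.2 ω, z s.1 s.2.1 s.2.2 ω))
    {t : ℕ} (htT : t ≤ T) (hm : M / (t - 1) + 2 ≤ p)
    {A : Set (ℕ × ℕ × ℕ)} (hA : A ⊆ validIndex T n M) {R : Ω → EuclideanSpace ℝ (Fin p)}
    {e : EuclideanSpace ℝ (Fin p) → ℝ} (hR : HasExpectedError μ ξ A R e) (D : List ℕ)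
    (hD : D.Nodup) (hDt : ∀ h ∈ D, 1 ≤ h ∧ h < t) (hDA : ∀ s ∈ A, s.1 = t → s.2.1 ∉ D) :
    HasExpectedError μ ξ (A ∪ {s | s ∈ jointIndex n M t D})
      (fun ω => D.foldl (fun v h => _root_.nearestPoint v (randomInterpolants n M wstar x z t h ω))
        (R ω))
      fun θ => (1 - (M / (t - 1) : ℕ) / (p : ℝ)) ^ D.length * e θ +
        ∑ h ∈ D.toFinset, (1 - (M / (t - 1) : ℕ) / (p : ℝ)) ^ (D.length - (D.idxOf h + 1)) *
          ((M / (t - 1) : ℕ) / (p : ℝ) * ‖wstar h - θ‖ ^ 2 +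
            (M / (t - 1) : ℕ) * (σ : ℝ) ^ 2 / ((p : ℝ) - (M / (t - 1) : ℕ) - 1)) := by
  induction D using List.reverseRecOn with
  | nil => exact hR.mono Set.subset_union_left fun θ => by simp
  | append_singleton D h ih =>
    have hnd := List.nodup_append.1 hD
    have hhD : h ∉ D := fun hh => hnd.2.2 h hh h (by simp) rfl
    have hht := hDt h (by simp)
    have hcount := sampleCount_of_lt (n := n) (M := M) hht.2
    have hjV : ∀ D', (∀ k ∈ D', 1 ≤ k ∧ k < t) → ∀ s ∈ jointIndex n M t D',
        s ∈ validIndex T n M := fun D' hD' s hs => by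
      obtain ⟨h1, h2, h3⟩ := mem_jointIndex.1 hs
      obtain ⟨h4, h5⟩ := hD' _ h2
      exact ⟨by omega, by omega, h4, by omega, by rw [h1]; exact h3⟩
    have ih := ih hnd.1 (fun k hk => hDt k (by simp [hk]))
      fun s hs hst hsD => hDA s hs hst (by simp [hsD])
    have step := ih.nearestPoint hξ
      (Set.union_subset hA (hjV D fun k hk => hDt k (by simp [hk]))) (fun s => wstar s.2.1)
      (L := dataIndex n M t h) (nodup_dataIndex _ _ _ _)
      (fun s hs => hjV [h] (fun k hk => by rw [List.mem_singleton.1 hk]; exact hht) s (by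
        simpa [jointIndex] using hs))
      (fun s hs hsA => by
        obtain ⟨h1, h2, -⟩ := mem_dataIndex.1 hs
        rcases hsA with h3 | h3
        · exact hDA s h3 h1 (by simp [h2])
        · exact hhD (h2 ▸ (mem_jointIndex.1 h3).2.1))
      (by rw [length_dataIndex, hcount]; exact hm)
      (C := fun ω => randomInterpolants n M wstar x z t h ω) (by
        filter_upwards [hx] with ω hω
        ext w
        exact mem_randomInterpolants_iff wstar hω htT hht.1 hht.2.le w)
    simp only [List.foldl_append, List.foldl_cons, List.foldl_nil]
    refine step.mono ?_ fun θ => ?_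
    · rintro s ((hs | hs) | hs)
      · exact Or.inl hs
      · right
        obtain ⟨h1, h2, h3⟩ := mem_jointIndex.1 hs
        exact mem_jointIndex.2 ⟨h1, by simp [h2], h3⟩
      · right
        obtain ⟨h1, h2, h3⟩ := mem_dataIndex.1 hs
        exact mem_jointIndex.2 ⟨h1, by simp [h2], by rw [h2]; exact h3⟩
    · rw [length_dataIndex, hcount, pairDist_dataIndex,
        sum_map_dataIndex n M t h fun k => ‖wstar k - θ‖ ^ 2, hcount]
      have hfin : (D ++ [h]).toFinset = insert h D.toFinset := by
        ext a; simp
      rw [hfin, Finset.sum_insert (by simpa using hhD), List.idxOf_append_of_notMem hhD]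
      -- Appending h keeps the positions in D and lengthens the list by one, so every earlier
      -- contribution is contracted once more, while h itself enters with exponent 0.
      have hsum : ∀ k ∈ D.toFinset,
          (1 - (M / (t - 1) : ℕ) / (p : ℝ)) ^ ((D ++ [h]).length - ((D ++ [h]).idxOf k + 1)) *
          ((M / (t - 1) : ℕ) / (p : ℝ) * ‖wstar k - θ‖ ^ 2 +
            (M / (t - 1) : ℕ) * (σ : ℝ) ^ 2 / ((p : ℝ) - (M / (t - 1) : ℕ) - 1)) =
          (1 - (M / (t - 1) : ℕ) / (p : ℝ)) *
            ((1 - (M / (t - 1) : ℕ) / (p : ℝ)) ^ (D.length - (D.idxOf k + 1)) *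
          ((M / (t - 1) : ℕ) / (p : ℝ) * ‖wstar k - θ‖ ^ 2 +
            (M / (t - 1) : ℕ) * (σ : ℝ) ^ 2 / ((p : ℝ) - (M / (t - 1) : ℕ) - 1))) := by
        intro k hk
        have hkD : k ∈ D := by simpa using hk
        have hlt := List.idxOf_lt_length_of_mem hkD
        rw [List.idxOf_append_of_mem hkD, ← mul_assoc, ← pow_succ']
        congr 2
        simp only [List.length_append, List.length_singleton]
        omega
      rw [Finset.sum_congr rfl hsum, ← Finset.mul_sum]
      simp only [List.length_append, List.length_singleton, List.idxOf_cons_self, add_zero,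
        Nat.sub_self, pow_zero, pow_succ]
      ring

/-- Expected error after the concurrent training at time `t`, if it was `e` before. -/
noncomputable def jointError (p n M : ℕ) (σ : ℝ) (S : Finset ℕ)
    (w : ℕ → EuclideanSpace ℝ (Fin p)) (t : ℕ) (e : ℝ) (θ : EuclideanSpace ℝ (Fin p)) : ℝ :=
  (1 - (n + S.card * (M / (t - 1) : ℕ) : ℝ) / p) * e
    + 1 / (p : ℝ) * (n * ‖w t - θ‖ ^ 2 + ∑ h ∈ S, (M / (t - 1) : ℕ) * ‖w h - θ‖ ^ 2
      + (n * (M / (t - 1) : ℕ) * ∑ h ∈ S, ‖w t - w h‖ ^ 2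
        + ((M / (t - 1) : ℕ) : ℝ) ^ 2 * (∑ h ∈ S, ∑ k ∈ S, ‖w h - w k‖ ^ 2) / 2)
        / ((p : ℝ) - (n + S.card * (M / (t - 1) : ℕ)) - 1))
    + (n + S.card * (M / (t - 1) : ℕ)) * σ ^ 2
        / ((p : ℝ) - (n + S.card * (M / (t - 1) : ℕ)) - 1)

/-- The current data and all memories in S form a single block. With m = M / (t - 1), halving the
ordered pair sum counts the n·m sample pairs between task t and a memory once; the memory pairs keep
their factor 1/2 because they are still summed in both orders. -/
theorem HasExpectedError.joint (hξ : IndepSamples μ (validIndex T n M) σ ξ)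
    (hx : ∀ᵐ ω ∂μ, ∀ s ∈ validIndex T n M, ξ s ω = (x s.1 s.2.1 s.2.2 ω, z s.1 s.2.1 s.2.2 ω))
    {t : ℕ} (ht1 : 1 ≤ t) (htT : t ≤ T) {S : Finset ℕ} (hS : ∀ h ∈ S, 1 ≤ h ∧ h < t)
    (hm : n + S.card * (M / (t - 1)) + 2 ≤ p)
    {A : Set (ℕ × ℕ × ℕ)} (hA : A ⊆ validIndex T n M) (hAt : ∀ s ∈ A, s.1 < t)
    {R : Ω → EuclideanSpace ℝ (Fin p)} {e : EuclideanSpace ℝ (Fin p) → ℝ}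
    (hR : HasExpectedError μ ξ A R e) :
    HasExpectedError μ ξ (A ∪ {s | s ∈ jointIndex n M t (t :: S.toList)})
      (fun ω => _root_.nearestPoint (R ω) (randomInterpolants n M wstar x z t t ω ∩
        ⋂ h ∈ S, randomInterpolants n M wstar x z t h ω))
      fun θ => jointError p n M σ S wstar t (e θ) θ := by
  have htS : t ∉ S := fun h => lt_irrefl _ (hS t h).2
  have hcount : ∀ h ∈ S, sampleCount n M t h = M / (t - 1) := fun h hh =>
    sampleCount_of_lt (hS h hh).2
  have hsum : ∀ f : ℕ → ℝ, (((t :: S.toList).map fun h => sampleCount n M t h * f h).sum : ℝ) =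
      n * f t + ∑ h ∈ S, (M / (t - 1) : ℕ) * f h := fun f => by
    rw [List.map_cons, List.sum_cons, sampleCount_self, Finset.sum_map_toList]
    congr 1
    exact Finset.sum_congr rfl fun h hh => by rw [hcount h hh]
  have hlenR : ((jointIndex n M t (t :: S.toList)).length : ℝ) =
      n + S.card * (M / (t - 1) : ℕ) := by
    have := hsum fun _ => 1
    simp only [mul_one] at this
    rw [length_jointIndex, this, Finset.sum_const, nsmul_eq_mul]
  have hlen : (jointIndex n M t (t :: S.toList)).length = n + S.card * (M / (t - 1)) := by
    exact_mod_cast hlenR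
  have hmem : ∀ h ∈ t :: S.toList, 1 ≤ h ∧ h ≤ t := fun h hh => by
    rcases List.mem_cons.1 hh with rfl | hh
    · exact ⟨ht1, le_rfl⟩
    · exact ⟨(hS h (by simpa using hh)).1, (hS h (by simpa using hh)).2.le⟩
  have step := hR.nearestPoint hξ hA (fun s => wstar s.2.1)
    (L := jointIndex n M t (t :: S.toList))
    (nodup_jointIndex n M t (List.nodup_cons.2 ⟨by simpa using htS, S.nodup_toList⟩))
    (fun s hs => by
      obtain ⟨h1, h2, h3⟩ := mem_jointIndex.1 hs
      obtain ⟨h4, h5⟩ := hmem _ h2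
      exact ⟨by omega, by omega, h4, by omega, by rw [h1]; exact h3⟩)
    (fun s hs hsA => by
      have h1 := (mem_jointIndex.1 hs).1
      have h2 := hAt s hsA
      omega)
    (by rw [hlen]; exact hm)
    (C := fun ω => randomInterpolants n M wstar x z t t ω ∩
        ⋂ h ∈ S, randomInterpolants n M wstar x z t h ω) (by
      filter_upwards [hx] with ω hω
      ext w
      simp only [Set.mem_inter_iff, Set.mem_iInter, jointIndex, List.mem_flatMap,
        Set.mem_ofPred_eq]
      constructor
      · rintro ⟨h1, h2⟩ s ⟨h, hh, hs⟩
        obtain ⟨h4, h5⟩ := hmem h hh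
        refine (mem_randomInterpolants_iff wstar hω htT h4 h5 w).1 ?_ s hs
        rcases List.mem_cons.1 hh with rfl | hh
        · exact h1
        · exact h2 h (by simpa using hh)
      · intro hw
        refine ⟨(mem_randomInterpolants_iff wstar hω htT ht1 le_rfl w).2
          fun s hs => hw s ⟨t, by simp, hs⟩, fun h hh => ?_⟩
        exact (mem_randomInterpolants_iff wstar hω htT (hS h hh).1 (hS h hh).2.le w).2
          fun s hs => hw s ⟨h, by simp [hh], hs⟩)
  refine step.mono subset_rfl fun θ => ?_
  rw [pairDist_jointIndex, sum_map_jointIndex n M t _ fun h => ‖wstar h - θ‖ ^ 2, hsum, hlenR]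
  simp_rw [hsum]
  simp only [jointError, sub_self, norm_zero]
  have h1 : ∀ h, ‖wstar h - wstar t‖ = ‖wstar t - wstar h‖ := fun h => norm_sub_rev _ _
  simp_rw [h1]
  simp only [mul_add, ← Finset.mul_sum, Finset.sum_add_distrib]
  ring

end TaskStep

/-! ### Recursion over the tasks. -/

section Recursion

variable {p : ℕ}

/-- Expected error after the training at time `t`, if it was `e` before. -/
noncomputable def taskError (p n M : ℕ) (σ : ℝ) (sim : ℕ → Finset ℕ) (dis : ℕ → List ℕ)
    (w : ℕ → EuclideanSpace ℝ (Fin p)) (t : ℕ) (e : ℝ) (θ : EuclideanSpace ℝ (Fin p)) : ℝ :=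
  (1 - (M / (t - 1) : ℕ) / (p : ℝ)) ^ (dis t).length * jointError p n M σ (sim t) w t e θ +
    ∑ h ∈ (dis t).toFinset,
      (1 - (M / (t - 1) : ℕ) / (p : ℝ)) ^ ((dis t).length - ((dis t).idxOf h + 1)) *
        ((M / (t - 1) : ℕ) / (p : ℝ) * ‖w h - θ‖ ^ 2 +
          (M / (t - 1) : ℕ) * σ ^ 2 / ((p : ℝ) - (M / (t - 1) : ℕ) - 1))

/-- Expected error of the parameters `w_t` with respect to `θ`. -/
noncomputable def expectedError (p n M : ℕ) (σ : ℝ) (sim : ℕ → Finset ℕ) (dis : ℕ → List ℕ)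
    (w : ℕ → EuclideanSpace ℝ (Fin p)) : ℕ → EuclideanSpace ℝ (Fin p) → ℝ
  | 0, θ => ‖θ‖ ^ 2
  | t + 1, θ => taskError p n M σ sim dis w (t + 1) (expectedError p n M σ sim dis w t θ) θ

/-- The parameters after task t depend only on samples with time index at most t, so all data of
time t + 1 are fresh; disjointness of `sim` and `dis` keeps the blocks within that time disjoint as
well. -/
theorem hasExpectedError_randomHybridWeights {Ω : Type*} [MeasurableSpace Ω] {μ : Measure Ω}
    [IsProbabilityMeasure μ] {T n M : ℕ} {σ : ℝ≥0}
    {ξ : ℕ × ℕ × ℕ → Ω → EuclideanSpace ℝ (Fin p) × ℝ}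
    {x : ℕ → ℕ → ℕ → Ω → EuclideanSpace ℝ (Fin p)} {z : ℕ → ℕ → ℕ → Ω → ℝ}
    (hn : 0 < n) {sim : ℕ → Finset ℕ} {dis : ℕ → List ℕ}
    (hnodup : ∀ t, 1 ≤ t → t ≤ T → (dis t).Nodup)
    (hdisj : ∀ t, 1 ≤ t → t ≤ T → Disjoint (sim t) (dis t).toFinset)
    (hsim : ∀ t, 1 ≤ t → t ≤ T → ∀ h ∈ sim t, 1 ≤ h ∧ h < t)
    (hdis : ∀ t, 1 ≤ t → t ≤ T → ∀ h ∈ dis t, 1 ≤ h ∧ h < t)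
    (hp : n + M < p)
    (hden : ∀ t, 1 ≤ t → t ≤ T → n + (sim t).card * (M / (t - 1)) + 1 ≠ p)
    (wstar : ℕ → EuclideanSpace ℝ (Fin p))
    (hξ : IndepSamples μ (validIndex T n M) σ ξ)
    (hx : ∀ᵐ ω ∂μ, ∀ s ∈ validIndex T n M, ξ s ω = (x s.1 s.2.1 s.2.2 ω, z s.1 s.2.1 s.2.2 ω))
    {t : ℕ} (ht : t ≤ T) :
    HasExpectedError μ ξ {s | s ∈ validIndex T n M ∧ s.1 ≤ t}
      (randomHybridWeights n M sim dis wstar x z t) (expectedError p n M σ sim dis wstar t) := by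
  induction t with
  | zero =>
    refine ⟨⟨fun _ => 0, measurable_const, Filter.Eventually.of_forall fun ω => rfl⟩,
      fun θ => ?_, fun θ => ?_⟩
    · simp [randomHybridWeights, hybridWeights]
    · simp [randomHybridWeights, hybridWeights, expectedError]
  | succ t ih =>
    have ih := ih (by omega)
    have hcard : (sim (t + 1)).card ≤ t := by
      have h1 : sim (t + 1) ⊆ Finset.Icc 1 t := fun h hh => by
        have := hsim (t + 1) (by omega) ht h hh
        rw [Finset.mem_Icc]; omega
      simpa using Finset.card_le_card h1
    -- At most t memories of size M / t, and none for t = 0. With `hp` the joint block is smaller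
    -- than p, and `hden` excludes p - 1, which leaves the two spare dimensions that the moments
    -- require.
    have hmul : (sim (t + 1)).card * (M / (t + 1 - 1)) ≤ M :=
      (Nat.mul_le_mul_right _ hcard).trans (by simpa using Nat.mul_div_le M t)
    have hm0 : M / (t + 1 - 1) ≤ M := Nat.div_le_self _ _
    have hd := hden (t + 1) (by omega) ht
    have h1 := ih.joint wstar hξ hx (t := t + 1) (by omega) ht (hsim _ (by omega) ht)
      (by omega) (fun s hs => hs.1) fun s hs => Nat.lt_succ_of_le hs.2
    have hjV : ∀ s ∈ jointIndex n M (t + 1) ((t + 1) :: (sim (t + 1)).toList),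
        s ∈ validIndex T n M := fun s hs => by
      obtain ⟨h1, h2, h3⟩ := mem_jointIndex.1 hs
      have h4 : 1 ≤ s.2.1 ∧ s.2.1 ≤ t + 1 := by
        rcases List.mem_cons.1 h2 with h | h
        · omega
        · have := hsim _ (by omega) ht _ (Finset.mem_toList.1 h); omega
      exact ⟨by omega, by omega, h4.1, by omega, by rw [h1]; exact h3⟩
    -- Here n ≥ 1 and n + M < p give M + 2 ≤ p, enough for one memory block.
    have h2 := h1.sequential wstar hξ hx ht (by omega)
      (Set.union_subset (fun s hs => hs.1) hjV)
      (dis (t + 1)) (hnodup _ (by omega) ht) (hdis _ (by omega) ht) (fun s hs hst hsD => by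
        rcases hs with hs | hs
        · have := hs.2; omega
        · rcases List.mem_cons.1 (mem_jointIndex.1 hs).2.1 with h | h
          · have := hdis _ (by omega) ht _ hsD; omega
          · exact Finset.disjoint_left.1 (hdisj (t + 1) (by omega) ht) (Finset.mem_toList.1 h)
              (List.mem_toFinset.2 hsD))
    refine h2.mono ?_ fun θ => rfl
    rintro s ((hs | hs) | hs)
    · exact ⟨hs.1, by have := hs.2; omega⟩
    · exact ⟨hjV s hs, (mem_jointIndex.1 hs).1.le⟩
    · obtain ⟨h3, h4, h5⟩ := mem_jointIndex.1 hs
      have h6 := hdis _ (by omega) ht _ h4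
      exact ⟨⟨by omega, by omega, h6.1, by omega, by rw [h3]; exact h5⟩, h3.le⟩

/-- Error added by the training at time `t - l`, as seen at time `t`. -/
noncomputable def taskIncrement (p n M : ℕ) (σ : ℝ≥0) (sim : ℕ → Finset ℕ) (dis : ℕ → List ℕ)
    (w : ℕ → EuclideanSpace ℝ (Fin p)) (l t : ℕ) (θ : EuclideanSpace ℝ (Fin p)) : ℝ :=
  (1 - coeffB p M l t) ^ (dis (t - l)).length *
      ((1 - coeffR p n 0) * ‖w (t - l) - θ‖ ^ 2
        + ∑ h ∈ sim (t - l), coeffB p M l t * ‖w h - θ‖ ^ 2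
        + n * coeffK p n M sim l t * ∑ h ∈ sim (t - l), ‖w (t - l) - w h‖ ^ 2
        + p * coeffB p M l t * coeffK p n M sim l t *
          (∑ h ∈ sim (t - l), ∑ k ∈ sim (t - l), ‖w h - w k‖ ^ 2) / 2
        + coeffLambda p ((n : ℝ) + (p : ℝ) * ((sim (t - l)).card : ℝ) * coeffB p M l t) σ)
    + ∑ h ∈ (dis (t - l)).toFinset,
      (1 - coeffB p M l t) ^ ((dis (t - l)).length - disPos dis (t - l) h) *
        (coeffB p M l t * ‖w h - θ‖ ^ 2 + coeffLambda p (memShare M l t) σ)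

variable {T n M : ℕ} {sim : ℕ → Finset ℕ} {dis : ℕ → List ℕ}

/-- Divisibility makes the natural division exact. At l = t - 1 both denominators are 0 and both
quotients are 0, so the first task needs no separate treatment. -/
lemma memShare_eq (hdvd : ∀ t, 2 ≤ t → t ≤ T → (t - 1) ∣ M) {l t : ℕ} (hl : l < t) (ht : t ≤ T) :
    memShare M l t = (M / (t - l - 1) : ℕ) := by
  have h1 : ((t : ℝ) - l - 1) = ((t - l - 1 : ℕ) : ℝ) := by
    rw [Nat.cast_sub (by omega), Nat.cast_sub hl.le, Nat.cast_one]
  rw [memShare, h1]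
  rcases Nat.eq_zero_or_pos (t - l - 1) with h0 | h0
  · simp [h0]
  · rw [Nat.cast_div (hdvd (t - l) (by omega) (by omega)) (by positivity)]

lemma coeffB_eq (hdvd : ∀ t, 2 ≤ t → t ≤ T → (t - 1) ∣ M) {l t : ℕ} (hl : l < t) (ht : t ≤ T) :
    coeffB p M l t = (M / (t - l - 1) : ℕ) / (p : ℝ) := by
  rw [coeffB, memShare_eq hdvd hl ht]
  split_ifs with h
  · rfl
  · have : t - l - 1 = 0 := by omega
    simp [this]

lemma taskError_eq (hp : 0 < p) (hdvd : ∀ t, 2 ≤ t → t ≤ T → (t - 1) ∣ M) (σ : ℝ≥0)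
    (w : ℕ → EuclideanSpace ℝ (Fin p)) {l t : ℕ} (hl : l < t) (ht : t ≤ T)
    (e : ℝ) (θ : EuclideanSpace ℝ (Fin p)) :
    taskError p n M σ sim dis w (t - l) e θ =
      (1 - coeffB p M l t) ^ (dis (t - l)).length *
        coeffR p n (memShare M l t * ((sim (t - l)).card : ℝ)) * e
      + taskIncrement p n M σ sim dis w l t θ := by
  have hp' : (p : ℝ) ≠ 0 := by positivity
  rw [taskError, taskIncrement, coeffK, coeffB_eq hdvd hl ht, memShare_eq hdvd hl ht]
  simp only [disPos, coeffLambda, coeffR, jointError, add_zero]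
  rw [← add_assoc, mul_assoc _ _ e]
  congr 1
  rw [← mul_add]
  congr 1
  set m : ℝ := ((M / (t - l - 1) : ℕ) : ℝ)
  have h1 : (n : ℝ) + p * (sim (t - l)).card * (m / p) = n + (sim (t - l)).card * m := by
    field_simp
  have h2 : (p : ℝ) - n - m * (sim (t - l)).card - 1 = p - (n + (sim (t - l)).card * m) - 1 := by
    ring
  rw [h1, h2, ← Finset.mul_sum, ← Finset.mul_sum]
  set c : ℝ := (p : ℝ) - (n + (sim (t - l)).card * m) - 1
  have h3 : (p : ℝ) * (m / p) * (m / p / c) = m ^ 2 / (p * c) := by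
    field_simp
  rw [h3]
  have h4 : (m / p / c) = m / (p * c) := by rw [div_div]
  rw [h4]
  -- If c = 0, the quotients by c are 0 on both sides, so this algebraic identity holds without the
  -- nondegeneracy assumption.
  rcases eq_or_ne c 0 with hc | hc
  · simp only [hc, div_zero, mul_zero, zero_mul, zero_div, add_zero]
    field_simp
    ring
  · field_simp
    ring

/-- Unrolls the affine recursion a tasks back from t: Γ_t(a) is the product of the contraction
factors at times t, t-1, …, t-a+1. -/
lemma expectedError_eq_aux (hp : 0 < p) (hdvd : ∀ t, 2 ≤ t → t ≤ T → (t - 1) ∣ M) (σ : ℝ≥0)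
    (w : ℕ → EuclideanSpace ℝ (Fin p)) {t : ℕ} (ht : t ≤ T) (θ : EuclideanSpace ℝ (Fin p))
    (a : ℕ) (ha : a ≤ t) :
    expectedError p n M σ sim dis w t θ =
      coeffGamma p n M sim dis t a * expectedError p n M σ sim dis w (t - a) θ
      + ∑ l ∈ Finset.range a, coeffGamma p n M sim dis t l *
          taskIncrement p n M σ sim dis w l t θ := by
  induction a with
  | zero => simp [coeffGamma]
  | succ a ih =>
    obtain ⟨b, hb⟩ : ∃ b, t - a = b + 1 := ⟨t - a - 1, by omega⟩
    have hb' : t - (a + 1) = b := by omega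
    rw [ih (by omega), Finset.sum_range_succ, hb', hb, expectedError, ← hb,
      taskError_eq hp hdvd σ w (by omega) ht]
    have hG : coeffGamma p n M sim dis t (a + 1) = coeffGamma p n M sim dis t a *
        ((1 - coeffB p M a t) ^ (dis (t - a)).length *
          coeffR p n (memShare M a t * ((sim (t - a)).card : ℝ))) := by
      rw [coeffGamma, Finset.prod_range_succ]; rfl
    rw [hG]
    ring

/-- Unrolled recursion for the expected error. -/
lemma expectedError_eq (hp : 0 < p) (hdvd : ∀ t, 2 ≤ t → t ≤ T → (t - 1) ∣ M)
    (hsim : sim 1 = ∅) (hdis : dis 1 = []) (σ : ℝ≥0)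
    (w : ℕ → EuclideanSpace ℝ (Fin p)) {t : ℕ} (ht1 : 1 ≤ t) (ht : t ≤ T)
    (θ : EuclideanSpace ℝ (Fin p)) :
    expectedError p n M σ sim dis w t θ =
      hybridD0 p n M sim dis t * ‖θ‖ ^ 2
      + ∑ l ∈ Finset.range t, coeffGamma p n M sim dis t l *
          taskIncrement p n M σ sim dis w l t θ := by
  rw [expectedError_eq_aux hp hdvd σ w ht θ t le_rfl, Nat.sub_self, expectedError]
  congr 2
  obtain ⟨s, rfl⟩ : ∃ s, t = s + 1 := ⟨t - 1, by omega⟩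
  -- The factor l = t - 1 belongs to the first task, which has no memories, and equals r_0.
  rw [hybridD0, coeffGamma, Finset.prod_range_succ, mul_comm]
  simp [hsim, hdis, coeffGamma]

end Recursion

/-! ### Sorting the unrolled sum into the coefficients of the theorem. -/

section Coefficients

/-- Splits the sum over unordered pairs into the pairs that contain `i` and the others. -/
lemma sum_pairs_split {s : Finset ℕ} {i : ℕ} (hi : i ∈ s) {F : ℕ → ℕ → ℝ}
    (hsymm : ∀ j k, F j k = F k j) (h0 : ∀ j, F j j = 0) :
    (∑ j ∈ s, ∑ k ∈ s, F j k) / 2 = ∑ j ∈ s, F j i +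
      ∑ j ∈ s, ∑ k ∈ s, if j < k ∧ j ≠ i ∧ k ≠ i then F j k else 0 := by
  -- At j = k = i two indicators fire at once, which is harmless since F vanishes on the diagonal.
  have key : ∀ j k, F j k = (if k = i then F j k else 0) + (if j = i then F j k else 0)
      + (if j < k ∧ j ≠ i ∧ k ≠ i then F j k else 0)
      + (if k < j ∧ k ≠ i ∧ j ≠ i then F k j else 0) := by
    intro j k
    by_cases hk : k = i
    · by_cases hj : j = i
      · simp [hj, hk, h0]
      · simp [hj, hk]
    · by_cases hj : j = i
      · simp [hj, hk]
      · rcases lt_trichotomy j k with h | h | h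
        · simp [hj, hk, h, h.le]
        · simp [hk, h, h0]
        · simp [hj, hk, h, h.le, hsymm j k]
  have h1 : ∑ j ∈ s, ∑ k ∈ s, F j k = ∑ j ∈ s, ∑ k ∈ s, ((if k = i then F j k else 0)
      + (if j = i then F j k else 0) + (if j < k ∧ j ≠ i ∧ k ≠ i then F j k else 0)
      + (if k < j ∧ k ≠ i ∧ j ≠ i then F k j else 0)) :=
    Finset.sum_congr rfl fun j _ => Finset.sum_congr rfl fun k _ => key j k
  rw [h1]
  simp only [Finset.sum_add_distrib]
  have h2 : ∑ j ∈ s, ∑ k ∈ s, (if k = i then F j k else 0) = ∑ j ∈ s, F j i :=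
    Finset.sum_congr rfl fun j _ => by rw [Finset.sum_ite_eq' s i, if_pos hi]
  have h3 : ∑ j ∈ s, ∑ k ∈ s, (if j = i then F j k else 0) = ∑ j ∈ s, F j i := by
    rw [Finset.sum_comm, ← h2, Finset.sum_comm]
    rw [Finset.sum_comm]
    exact Finset.sum_congr rfl fun j _ => Finset.sum_congr rfl fun k _ => by rw [hsymm]
  rw [h3, h2, Finset.sum_comm (f := fun j k => if k < j ∧ k ≠ i ∧ j ≠ i then F k j else 0)]
  ring

lemma sum_range_sub (t : ℕ) (f : ℕ → ℕ → ℝ) :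
    ∑ l ∈ Finset.range t, f l (t - l) = ∑ j ∈ Finset.Icc 1 t, f (t - j) j := by
  refine Finset.sum_nbij' (fun l => t - l) (fun j => t - j) ?_ ?_ ?_ ?_ ?_
  · intro l hl; rw [Finset.mem_range] at hl; rw [Finset.mem_Icc]; omega
  · intro j hj; rw [Finset.mem_Icc] at hj; rw [Finset.mem_range]; omega
  · intro l hl; rw [Finset.mem_range] at hl; omega
  · intro j hj; rw [Finset.mem_Icc] at hj; omega
  · intro l hl
    rw [Finset.mem_range] at hl
    rw [show t - (t - l) = l by omega]

lemma sum_eq_sum_indicator {S s : Finset ℕ} (h : S ⊆ s) (f : ℕ → ℝ) :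
    ∑ j ∈ S, f j = ∑ j ∈ s, (if j ∈ S then 1 else 0) * f j := by
  simp only [ite_mul, one_mul, zero_mul]
  rw [Finset.sum_ite_mem, Finset.inter_eq_right.2 h]

variable (p n M : ℕ) (sim : ℕ → Finset ℕ) (dis : ℕ → List ℕ)

/-- Coefficient of `‖w_j - w_i‖²` in the expected error that stems from fitting task `j`. -/
noncomputable def singleCoeff (j t : ℕ) : ℝ :=
  (∑ l ∈ Finset.range t, (1 - coeffB p M l t) ^ (dis (t - l)).length *
      coeffGamma p n M sim dis t l * coeffB p M l t * indSim sim (t - l) j)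
  + (1 - coeffB p M (t - j) t) ^ (dis j).length * coeffGamma p n M sim dis t (t - j) *
      (1 - coeffR p n 0)
  + ∑ l ∈ Finset.range t, coeffGamma p n M sim dis t l *
      (1 - coeffB p M l t) ^ ((dis (t - l)).length - disPos dis (t - l) j) *
        coeffB p M l t * indDis dis (t - l) j

/-- Coefficient of the pair `j, k` that stems from the memories of `j` and `k`. -/
noncomputable def memoryPairCoeff (j k t : ℕ) : ℝ :=
  ∑ l ∈ Finset.range t, (1 - coeffB p M l t) ^ (dis (t - l)).length *
    coeffGamma p n M sim dis t l * ((p : ℝ) * coeffB p M l t * coeffK p n M sim l t) *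
      indSim sim (t - l) j * indSim sim (t - l) k

/-- Coefficient of the pair `j, k` that stems from the memory of `j` at time `k`. -/
noncomputable def currentPairCoeff (j k t : ℕ) : ℝ :=
  (1 - coeffB p M (t - k) t) ^ (dis k).length * (n : ℝ) *
    coeffGamma p n M sim dis t (t - k) * coeffK p n M sim (t - k) t * indSim sim k j

variable {p n M sim dis} {T : ℕ}

lemma indSim_eq_zero (hsim : ∀ t, 1 ≤ t → t ≤ T → ∀ h ∈ sim t, 1 ≤ h ∧ h < t) {t j : ℕ}
    (h1 : 1 ≤ t) (hT : t ≤ T) (hj : t ≤ j) : indSim sim t j = 0 :=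
  if_neg fun h => absurd (hsim t h1 hT j h).2 (not_lt.2 hj)

lemma indDis_eq_zero (hdis : ∀ t, 1 ≤ t → t ≤ T → ∀ h ∈ dis t, 1 ≤ h ∧ h < t) {t j : ℕ}
    (h1 : 1 ≤ t) (hT : t ≤ T) (hj : t ≤ j) : indDis dis t j = 0 :=
  if_neg fun h => absurd (hdis t h1 hT j h).2 (not_lt.2 hj)

lemma coeffB_last (t : ℕ) : coeffB p M (t - 1) t = 0 := if_neg (by simp)

lemma sum_range_eq_of_le {a t : ℕ} (hat : a ≤ t) {f : ℕ → ℝ}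
    (hf : ∀ l, a ≤ l → l < t → f l = 0) :
    ∑ l ∈ Finset.range a, f l = ∑ l ∈ Finset.range t, f l := by
  refine Finset.sum_subset (Finset.range_subset_range.2 hat) fun l h1 h2 => ?_
  rw [Finset.mem_range] at h1 h2
  exact hf l (by omega) h1

/-- The extra index l = t - 1 contributes nothing because B_{t-1,t} = 0. -/
lemma memoryPairCoeff_eq {j k t : ℕ} (ht : 1 ≤ t) :
    memoryPairCoeff p n M sim dis j k t =
      ∑ l ∈ Finset.range (t - 1), (1 - coeffB p M l t) ^ (dis (t - l)).length *
        coeffGamma p n M sim dis t l * ((p : ℝ) * coeffB p M l t * coeffK p n M sim l t) *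
          indSim sim (t - l) j * indSim sim (t - l) k := by
  refine (sum_range_eq_of_le (Nat.sub_le t 1) fun l h1 h2 => ?_).symm
  obtain rfl : l = t - 1 := by omega
  rw [coeffB_last]; simp

lemma coeffGamma_zero (t : ℕ) : coeffGamma p n M sim dis t 0 = 1 := by simp [coeffGamma]

lemma memoryPairCoeff_self (hsim : ∀ t, 1 ≤ t → t ≤ T → ∀ h ∈ sim t, 1 ≤ h ∧ h < t) {j t : ℕ}
    (ht : t ≤ T) : memoryPairCoeff p n M sim dis j t t = 0 := by
  refine Finset.sum_eq_zero fun l hl => ?_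
  rw [Finset.mem_range] at hl
  rw [indSim_eq_zero hsim (t := t - l) (j := t) (by omega) (by omega) (by omega), mul_zero]

/-- The ranges may be extended from t - j to t: the added terms belong to times t - l ≤ j, whose
memories do not contain j. For j = t the same reason removes every term with j in a memory. -/
lemma hybridD_self (hsim : ∀ t, 1 ≤ t → t ≤ T → ∀ h ∈ sim t, 1 ≤ h ∧ h < t)
    (hdis : ∀ t, 1 ≤ t → t ≤ T → ∀ h ∈ dis t, 1 ≤ h ∧ h < t) {i j t : ℕ}
    (hi : 1 ≤ i) (hit : i ≤ t) (ht : t ≤ T) (hj : 1 ≤ j) (hjt : j ≤ t) :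
    hybridD p n M sim dis i j i t = singleCoeff p n M sim dis j t
      + (memoryPairCoeff p n M sim dis j i t + currentPairCoeff p n M sim dis j i t
        + currentPairCoeff p n M sim dis i j t) := by
  rcases hjt.lt_or_eq with hlt | rfl
  · rw [hybridD, if_pos ⟨rfl, hlt⟩, memoryPairCoeff_eq (by omega), singleCoeff, currentPairCoeff,
      currentPairCoeff,
      sum_range_eq_of_le (a := t - j) (t := t) (Nat.sub_le _ _) fun l h1 h2 => by
        rw [indSim_eq_zero hsim (by omega) (by omega) (by omega), mul_zero],
      sum_range_eq_of_le (a := t - j) (t := t) (Nat.sub_le _ _) fun l h1 h2 => by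
        rw [indDis_eq_zero hdis (by omega) (by omega) (by omega), mul_zero]]
    ring
  · have h1 : memoryPairCoeff p n M sim dis j i j = 0 := Finset.sum_eq_zero fun l hl => by
      rw [Finset.mem_range] at hl
      rw [indSim_eq_zero hsim (t := j - l) (j := j) (by omega) (by omega) (by omega)]
      ring
    have h2 : currentPairCoeff p n M sim dis j i j = 0 := by
      rw [currentPairCoeff, indSim_eq_zero hsim hi (by omega) hit, mul_zero]
    rw [hybridD, if_neg (by simp), if_pos ⟨rfl, rfl⟩, h1, h2, singleCoeff, currentPairCoeff,
      Finset.sum_eq_zero fun l hl => by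
        rw [Finset.mem_range] at hl
        rw [indSim_eq_zero hsim (t := j - l) (j := j) (by omega) (by omega) (by omega), mul_zero],
      Finset.sum_eq_zero fun l hl => by
        rw [Finset.mem_range] at hl
        rw [indDis_eq_zero hdis (t := j - l) (j := j) (by omega) (by omega) (by omega), mul_zero]]
    rw [Nat.sub_self, coeffGamma_zero]
    ring

/-- For j < k the memory at time j cannot contain k, so the last summand is 0; it is included to
make the expression symmetric in j and k. -/
lemma hybridD_of_ne (hsim : ∀ t, 1 ≤ t → t ≤ T → ∀ h ∈ sim t, 1 ≤ h ∧ h < t)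
    {i j k t : ℕ} (ht1 : 1 ≤ t) (ht : t ≤ T) (hj : 1 ≤ j) (hkt : k ≤ t) (hki : k ≠ i) :
    hybridD p n M sim dis i j k t = if j < k ∧ j ≠ i ∧ k ≠ i then
      memoryPairCoeff p n M sim dis j k t + currentPairCoeff p n M sim dis j k t
        + currentPairCoeff p n M sim dis k j t else 0 := by
  rw [hybridD, if_neg fun h => hki h.1, if_neg fun h => hki h.1]
  by_cases h : j < k ∧ j ≠ i ∧ k ≠ i
  · have h0 : currentPairCoeff p n M sim dis k j t = 0 := by
      rw [currentPairCoeff, indSim_eq_zero hsim hj (by omega) h.1.le, mul_zero]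
    rw [if_pos h, h0, add_zero]
    rcases hkt.lt_or_eq with hlt | rfl
    · rw [if_pos ⟨h.1, hlt, h.2⟩, memoryPairCoeff_eq ht1, currentPairCoeff]
    · rw [if_neg (by simp), if_pos ⟨h.1, rfl, h.2⟩, memoryPairCoeff_self hsim ht, currentPairCoeff,
        Nat.sub_self, coeffGamma_zero]
      ring
  · rw [if_neg h, if_neg fun h' => h ⟨h'.1, h'.2.2⟩, if_neg fun h' => h ⟨h'.1, h'.2.2⟩]

lemma hybridD_eq_zero {i j k t : ℕ} (hit : i ≤ t) (h : t < j ∨ t < k) :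
    hybridD p n M sim dis i j k t = 0 := by
  rw [hybridD, if_neg (by omega), if_neg (by omega), if_neg (by omega), if_neg (by omega)]

lemma memoryPairCoeff_comm (j k t : ℕ) :
    memoryPairCoeff p n M sim dis j k t = memoryPairCoeff p n M sim dis k j t :=
  Finset.sum_congr rfl fun l _ => by ring

/-- The distance terms of the expected error, written with coefficients independent of `i`. -/
lemma sum_hybridD_mul (hsim : ∀ t, 1 ≤ t → t ≤ T → ∀ h ∈ sim t, 1 ≤ h ∧ h < t)
    (hdis : ∀ t, 1 ≤ t → t ≤ T → ∀ h ∈ dis t, 1 ≤ h ∧ h < t) {i t : ℕ}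
    (hi : 1 ≤ i) (hit : i ≤ t) (ht : t ≤ T) {δ : ℕ → ℕ → ℝ} (hδ : ∀ j k, δ j k = δ k j)
    (hδ0 : ∀ j, δ j j = 0) :
    ∑ j ∈ Finset.Icc 1 T, ∑ k ∈ Finset.Icc 1 T, hybridD p n M sim dis i j k t * δ j k =
      ∑ j ∈ Finset.Icc 1 t, singleCoeff p n M sim dis j t * δ j i
      + ∑ k ∈ Finset.Icc 1 t, ∑ j ∈ Finset.Icc 1 t, currentPairCoeff p n M sim dis j k t * δ j k
      + (∑ j ∈ Finset.Icc 1 t, ∑ k ∈ Finset.Icc 1 t,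
          memoryPairCoeff p n M sim dis j k t * δ j k) / 2 := by
  have hsub : Finset.Icc 1 t ⊆ Finset.Icc 1 T := Finset.Icc_subset_Icc_right ht
  have h1 : ∑ j ∈ Finset.Icc 1 T, ∑ k ∈ Finset.Icc 1 T, hybridD p n M sim dis i j k t * δ j k =
      ∑ j ∈ Finset.Icc 1 t, ∑ k ∈ Finset.Icc 1 t, hybridD p n M sim dis i j k t * δ j k := by
    symm
    refine (Finset.sum_congr rfl fun j _ => Finset.sum_subset hsub fun k h1 h2 => ?_).trans
      (Finset.sum_subset hsub fun j h1 h2 => Finset.sum_eq_zero fun k _ => ?_)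
    · rw [Finset.mem_Icc] at h1 h2
      exact mul_eq_zero_of_left (hybridD_eq_zero hit (Or.inr (by omega))) _
    · rw [Finset.mem_Icc] at h1 h2
      exact mul_eq_zero_of_left (hybridD_eq_zero hit (Or.inl (by omega))) _
  -- The full symmetric weight of a pair of tasks, to which `sum_pairs_split` applies.
  let F : ℕ → ℕ → ℝ := fun j k => (memoryPairCoeff p n M sim dis j k t
    + currentPairCoeff p n M sim dis j k t + currentPairCoeff p n M sim dis k j t) * δ j k
  have hF : ∀ j k, F j k = F k j := fun j k => by
    simp only [F]; rw [memoryPairCoeff_comm, hδ]; ring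
  have hF0 : ∀ j, F j j = 0 := fun j => by simp only [F]; rw [hδ0, mul_zero]
  have himem : i ∈ Finset.Icc 1 t := Finset.mem_Icc.2 ⟨hi, hit⟩
  have h2 : ∀ j ∈ Finset.Icc 1 t, ∀ k ∈ Finset.Icc 1 t, hybridD p n M sim dis i j k t * δ j k =
      (if k = i then singleCoeff p n M sim dis j t * δ j k + F j k else 0) +
        if j < k ∧ j ≠ i ∧ k ≠ i then F j k else 0 := by
    intro j hj k hk
    rw [Finset.mem_Icc] at hj hk
    by_cases hki : k = i
    · subst hki
      rw [hybridD_self hsim hdis hi hit ht hj.1 hj.2]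
      simp only [F, if_true, ne_eq, not_true_eq_false, and_false, if_false]
      ring
    · rw [hybridD_of_ne hsim (by omega) ht hj.1 hk.2 hki, if_neg hki, zero_add, ite_mul, zero_mul]
  rw [h1, Finset.sum_congr rfl fun j hj => Finset.sum_congr rfl fun k hk => h2 j hj k hk]
  simp only [Finset.sum_add_distrib, Finset.sum_ite_eq', himem, if_true]
  have h3 := sum_pairs_split himem hF hF0
  have h4 : ∑ j ∈ Finset.Icc 1 t, ∑ k ∈ Finset.Icc 1 t, F j k =
      ∑ j ∈ Finset.Icc 1 t, ∑ k ∈ Finset.Icc 1 t, memoryPairCoeff p n M sim dis j k t * δ j k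
      + ∑ k ∈ Finset.Icc 1 t, ∑ j ∈ Finset.Icc 1 t, currentPairCoeff p n M sim dis j k t * δ j k
      + ∑ k ∈ Finset.Icc 1 t, ∑ j ∈ Finset.Icc 1 t,
          currentPairCoeff p n M sim dis j k t * δ j k := by
    rw [Finset.sum_comm (f := fun k j => currentPairCoeff p n M sim dis j k t * δ j k)]
    -- The two current-task contributions agree after swapping j and k, so together they absorb the
    -- factor 1/2.
    have h5 : ∑ j ∈ Finset.Icc 1 t, ∑ k ∈ Finset.Icc 1 t,
        currentPairCoeff p n M sim dis j k t * δ j k = ∑ j ∈ Finset.Icc 1 t, ∑ k ∈ Finset.Icc 1 t,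
        currentPairCoeff p n M sim dis k j t * δ j k := by
      rw [Finset.sum_comm]
      exact Finset.sum_congr rfl fun j _ => Finset.sum_congr rfl fun k _ => by rw [hδ]
    nth_rewrite 2 [h5]
    simp only [← Finset.sum_add_distrib]
    exact Finset.sum_congr rfl fun j _ => Finset.sum_congr rfl fun k _ => by simp only [F]; ring
  rw [add_assoc, ← h3, h4]
  ring

/-- The sum of the increments, sorted by pairs of tasks. -/
lemma sum_taskIncrement (hsim : ∀ t, 1 ≤ t → t ≤ T → ∀ h ∈ sim t, 1 ≤ h ∧ h < t)
    (hdis : ∀ t, 1 ≤ t → t ≤ T → ∀ h ∈ dis t, 1 ≤ h ∧ h < t) (hsim1 : sim 1 = ∅) (hdis1 : dis 1 = [])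
    (σ : ℝ≥0) (w : ℕ → EuclideanSpace ℝ (Fin p)) {t : ℕ} (ht1 : 1 ≤ t) (ht : t ≤ T) (i : ℕ) :
    ∑ l ∈ Finset.range t, coeffGamma p n M sim dis t l *
        taskIncrement p n M σ sim dis w l t (w i) =
      ∑ j ∈ Finset.Icc 1 t, singleCoeff p n M sim dis j t * ‖w j - w i‖ ^ 2
      + ∑ k ∈ Finset.Icc 1 t, ∑ j ∈ Finset.Icc 1 t,
          currentPairCoeff p n M sim dis j k t * ‖w j - w k‖ ^ 2
      + (∑ j ∈ Finset.Icc 1 t, ∑ k ∈ Finset.Icc 1 t,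
          memoryPairCoeff p n M sim dis j k t * ‖w j - w k‖ ^ 2) / 2
      + hybridNoise p n M sim dis t σ := by
  have hS : ∀ l ∈ Finset.range t, sim (t - l) ⊆ Finset.Icc 1 t := fun l hl h hh => by
    rw [Finset.mem_range] at hl
    have := hsim (t - l) (by omega) (by omega) h hh
    rw [Finset.mem_Icc]; omega
  have hD : ∀ l ∈ Finset.range t, (dis (t - l)).toFinset ⊆ Finset.Icc 1 t := fun l hl h hh => by
    rw [Finset.mem_range] at hl
    have := hdis (t - l) (by omega) (by omega) h (List.mem_toFinset.1 hh)
    rw [Finset.mem_Icc]; omega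
  have hnoise : hybridNoise p n M sim dis t σ = ∑ l ∈ Finset.range t,
      coeffGamma p n M sim dis t l *
      ((∑ j ∈ (dis (t - l)).toFinset,
          (1 - coeffB p M l t) ^ ((dis (t - l)).length - disPos dis (t - l) j) *
            coeffLambda p (memShare M l t) σ)
        + (1 - coeffB p M l t) ^ (dis (t - l)).length *
            coeffLambda p ((n : ℝ) + (p : ℝ) * ((sim (t - l)).card : ℝ) * coeffB p M l t) σ) := by
    -- The separate last noise term is the general term at l = t - 1, since the first task has empty
    -- `sim` and `dis`.
    obtain ⟨s, rfl⟩ : ∃ s, t = s + 1 := ⟨t - 1, by omega⟩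
    rw [Finset.sum_range_succ, hybridNoise]
    simp [hsim1, hdis1]
  have hterm : ∀ l ∈ Finset.range t, coeffGamma p n M sim dis t l *
        taskIncrement p n M σ sim dis w l t (w i) =
      (∑ j ∈ Finset.Icc 1 t, ((1 - coeffB p M l t) ^ (dis (t - l)).length *
        coeffGamma p n M sim dis t l * coeffB p M l t * indSim sim (t - l) j) * ‖w j - w i‖ ^ 2)
      + (∑ j ∈ Finset.Icc 1 t, (coeffGamma p n M sim dis t l *
        (1 - coeffB p M l t) ^ ((dis (t - l)).length - disPos dis (t - l) j) *
          coeffB p M l t * indDis dis (t - l) j) * ‖w j - w i‖ ^ 2)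
      + ((1 - coeffB p M l t) ^ (dis (t - l)).length * coeffGamma p n M sim dis t l *
        (1 - coeffR p n 0)) * ‖w (t - l) - w i‖ ^ 2
      + (∑ j ∈ Finset.Icc 1 t, ((1 - coeffB p M l t) ^ (dis (t - l)).length * (n : ℝ) *
        coeffGamma p n M sim dis t l * coeffK p n M sim l t * indSim sim (t - l) j) *
          ‖w j - w (t - l)‖ ^ 2)
      + (∑ j ∈ Finset.Icc 1 t, ∑ k ∈ Finset.Icc 1 t,
        ((1 - coeffB p M l t) ^ (dis (t - l)).length *
          coeffGamma p n M sim dis t l * ((p : ℝ) * coeffB p M l t * coeffK p n M sim l t) *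
            indSim sim (t - l) j * indSim sim (t - l) k) * ‖w j - w k‖ ^ 2) / 2
      + coeffGamma p n M sim dis t l *
      ((∑ j ∈ (dis (t - l)).toFinset,
          (1 - coeffB p M l t) ^ ((dis (t - l)).length - disPos dis (t - l) j) *
            coeffLambda p (memShare M l t) σ)
        + (1 - coeffB p M l t) ^ (dis (t - l)).length *
            coeffLambda p ((n : ℝ) + (p : ℝ) * ((sim (t - l)).card : ℝ) * coeffB p M l t) σ) := by
    intro l hl
    have e1 : ∑ h ∈ sim (t - l), coeffB p M l t * ‖w h - w i‖ ^ 2 =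
        ∑ j ∈ Finset.Icc 1 t, indSim sim (t - l) j * (coeffB p M l t * ‖w j - w i‖ ^ 2) :=
      sum_eq_sum_indicator (hS l hl) _
    have e2 : ∑ h ∈ sim (t - l), ‖w (t - l) - w h‖ ^ 2 =
        ∑ j ∈ Finset.Icc 1 t, indSim sim (t - l) j * ‖w (t - l) - w j‖ ^ 2 :=
      sum_eq_sum_indicator (hS l hl) _
    have e3 : ∑ h ∈ sim (t - l), ∑ k ∈ sim (t - l), ‖w h - w k‖ ^ 2 =
        ∑ j ∈ Finset.Icc 1 t, indSim sim (t - l) j *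
          ∑ k ∈ Finset.Icc 1 t, indSim sim (t - l) k * ‖w j - w k‖ ^ 2 :=
      (sum_eq_sum_indicator (hS l hl) _).trans (Finset.sum_congr rfl fun j _ => by
        rw [sum_eq_sum_indicator (hS l hl)]; rfl)
    have e4 : ∑ h ∈ (dis (t - l)).toFinset,
        (1 - coeffB p M l t) ^ ((dis (t - l)).length - disPos dis (t - l) h) *
          (coeffB p M l t * ‖w h - w i‖ ^ 2) = ∑ j ∈ Finset.Icc 1 t, indDis dis (t - l) j *
        ((1 - coeffB p M l t) ^ ((dis (t - l)).length - disPos dis (t - l) j) *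
          (coeffB p M l t * ‖w j - w i‖ ^ 2)) := by
      rw [sum_eq_sum_indicator (hD l hl)]
      exact Finset.sum_congr rfl fun j _ => by simp [indDis]
    rw [taskIncrement]
    simp only [mul_add _ (coeffB p M l t * _) (coeffLambda _ _ _), Finset.sum_add_distrib]
    rw [e1, e2, e3, e4]
    have s1 : ∑ j ∈ Finset.Icc 1 t, ((1 - coeffB p M l t) ^ (dis (t - l)).length *
        coeffGamma p n M sim dis t l * coeffB p M l t * indSim sim (t - l) j) * ‖w j - w i‖ ^ 2 =
        coeffGamma p n M sim dis t l * (1 - coeffB p M l t) ^ (dis (t - l)).length *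
        ∑ j ∈ Finset.Icc 1 t, indSim sim (t - l) j * (coeffB p M l t * ‖w j - w i‖ ^ 2) := by
      rw [Finset.mul_sum]; exact Finset.sum_congr rfl fun _ _ => by ring
    have s2 : ∑ j ∈ Finset.Icc 1 t, (coeffGamma p n M sim dis t l *
        (1 - coeffB p M l t) ^ ((dis (t - l)).length - disPos dis (t - l) j) *
          coeffB p M l t * indDis dis (t - l) j) * ‖w j - w i‖ ^ 2 =
        coeffGamma p n M sim dis t l * ∑ j ∈ Finset.Icc 1 t, indDis dis (t - l) j *
        ((1 - coeffB p M l t) ^ ((dis (t - l)).length - disPos dis (t - l) j) *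
          (coeffB p M l t * ‖w j - w i‖ ^ 2)) := by
      rw [Finset.mul_sum]; exact Finset.sum_congr rfl fun _ _ => by ring
    have s3 : ∑ j ∈ Finset.Icc 1 t, ((1 - coeffB p M l t) ^ (dis (t - l)).length * (n : ℝ) *
        coeffGamma p n M sim dis t l * coeffK p n M sim l t * indSim sim (t - l) j) *
          ‖w j - w (t - l)‖ ^ 2 =
        coeffGamma p n M sim dis t l * (1 - coeffB p M l t) ^ (dis (t - l)).length *
          (n * coeffK p n M sim l t) *
          ∑ j ∈ Finset.Icc 1 t, indSim sim (t - l) j * ‖w (t - l) - w j‖ ^ 2 := by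
      rw [Finset.mul_sum]
      exact Finset.sum_congr rfl fun _ _ => by rw [norm_sub_rev (w (t - l))]; ring
    have s4 : ∑ j ∈ Finset.Icc 1 t, ∑ k ∈ Finset.Icc 1 t,
        ((1 - coeffB p M l t) ^ (dis (t - l)).length *
          coeffGamma p n M sim dis t l * ((p : ℝ) * coeffB p M l t * coeffK p n M sim l t) *
            indSim sim (t - l) j * indSim sim (t - l) k) * ‖w j - w k‖ ^ 2 =
        coeffGamma p n M sim dis t l * (1 - coeffB p M l t) ^ (dis (t - l)).length *
          ((p : ℝ) * coeffB p M l t * coeffK p n M sim l t) *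
          ∑ j ∈ Finset.Icc 1 t, indSim sim (t - l) j *
          ∑ k ∈ Finset.Icc 1 t, indSim sim (t - l) k * ‖w j - w k‖ ^ 2 := by
      simp only [Finset.mul_sum]
      exact Finset.sum_congr rfl fun _ _ => Finset.sum_congr rfl fun _ _ => by ring
    rw [s1, s2, s3, s4]
    ring
  rw [Finset.sum_congr rfl hterm]
  simp only [Finset.sum_add_distrib]
  -- In the terms that involve the task trained at time t - l, that task τ = t - l becomes the
  -- summation index.
  rw [← hnoise, ← Finset.sum_div, sum_range_sub t fun l τ =>
      ((1 - coeffB p M l t) ^ (dis τ).length * coeffGamma p n M sim dis t l *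
        (1 - coeffR p n 0)) * ‖w τ - w i‖ ^ 2,
    sum_range_sub t fun l τ => ∑ j ∈ Finset.Icc 1 t, ((1 - coeffB p M l t) ^ (dis τ).length *
      (n : ℝ) * coeffGamma p n M sim dis t l * coeffK p n M sim l t * indSim sim τ j) *
          ‖w j - w τ‖ ^ 2]
  have g1 : ∑ j ∈ Finset.Icc 1 t, singleCoeff p n M sim dis j t * ‖w j - w i‖ ^ 2 =
      (∑ l ∈ Finset.range t, ∑ j ∈ Finset.Icc 1 t, ((1 - coeffB p M l t) ^ (dis (t - l)).length *
        coeffGamma p n M sim dis t l * coeffB p M l t * indSim sim (t - l) j) * ‖w j - w i‖ ^ 2)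
      + (∑ l ∈ Finset.range t, ∑ j ∈ Finset.Icc 1 t, (coeffGamma p n M sim dis t l *
        (1 - coeffB p M l t) ^ ((dis (t - l)).length - disPos dis (t - l) j) *
          coeffB p M l t * indDis dis (t - l) j) * ‖w j - w i‖ ^ 2)
      + ∑ j ∈ Finset.Icc 1 t, ((1 - coeffB p M (t - j) t) ^ (dis j).length *
        coeffGamma p n M sim dis t (t - j) * (1 - coeffR p n 0)) * ‖w j - w i‖ ^ 2 := by
    rw [Finset.sum_comm (s := Finset.range t), Finset.sum_comm (s := Finset.range t),
      ← Finset.sum_add_distrib, ← Finset.sum_add_distrib]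
    refine Finset.sum_congr rfl fun j _ => ?_
    rw [singleCoeff, ← Finset.sum_mul, ← Finset.sum_mul]
    ring
  have g2 : ∑ j ∈ Finset.Icc 1 t, ∑ k ∈ Finset.Icc 1 t,
      memoryPairCoeff p n M sim dis j k t * ‖w j - w k‖ ^ 2 =
      ∑ l ∈ Finset.range t, ∑ j ∈ Finset.Icc 1 t, ∑ k ∈ Finset.Icc 1 t,
        ((1 - coeffB p M l t) ^ (dis (t - l)).length *
          coeffGamma p n M sim dis t l * ((p : ℝ) * coeffB p M l t * coeffK p n M sim l t) *
            indSim sim (t - l) j * indSim sim (t - l) k) * ‖w j - w k‖ ^ 2 := by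
    rw [Finset.sum_comm (s := Finset.range t)]
    refine Finset.sum_congr rfl fun j _ => ?_
    rw [Finset.sum_comm (s := Finset.range t)]
    refine Finset.sum_congr rfl fun k _ => ?_
    rw [memoryPairCoeff, Finset.sum_mul]
  rw [g1, g2]
  rfl

end Coefficients

/-! ### Forgetting and generalization error. -/

theorem mainTheorem7 {Ω : Type*} [MeasurableSpace Ω] (μ : MeasureTheory.Measure Ω)
    [MeasureTheory.IsProbabilityMeasure μ]
    (T p n M : ℕ) (σ : ℝ≥0) (hT : 2 ≤ T) (hn : 0 < n)
    (hdvd : ∀ t, 2 ≤ t → t ≤ T → (t - 1) ∣ M)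
    (sim : ℕ → Finset ℕ) (dis : ℕ → List ℕ)
    (hnodup : ∀ t, 1 ≤ t → t ≤ T → (dis t).Nodup)
    (hdisj : ∀ t, 1 ≤ t → t ≤ T → Disjoint (sim t) (dis t).toFinset)
    (hcover : ∀ t, 1 ≤ t → t ≤ T → sim t ∪ (dis t).toFinset = Finset.Icc 1 (t - 1))
    (hp : n + M < p)
    (hden : ∀ t, 1 ≤ t → t ≤ T → n + (sim t).card * (M / (t - 1)) + 1 ≠ p)
    (wstar : ℕ → EuclideanSpace ℝ (Fin p))
    (x : ℕ → ℕ → ℕ → Ω → EuclideanSpace ℝ (Fin p)) (z : ℕ → ℕ → ℕ → Ω → ℝ)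
    (hdata : GaussianData μ T n M σ x z) :
    (∀ i t, 1 ≤ i → i ≤ T → 1 ≤ t → t ≤ T → MeasureTheory.Integrable
      (fun ω => modelError wstar i (randomHybridWeights n M sim dis wstar x z t ω)) μ) ∧
    forgetting μ T wstar (randomHybridWeights n M sim dis wstar x z) =
      1 / ((T : ℝ) - 1) *
        ((∑ i ∈ Finset.Icc 1 (T - 1), hybridC0 p n M sim dis T i * ‖wstar i‖ ^ 2)
        + (∑ i ∈ Finset.Icc 1 (T - 1), ∑ j ∈ Finset.Icc 1 T, ∑ k ∈ Finset.Icc 1 T,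
            hybridC p n M sim dis T i j k * ‖wstar j - wstar k‖ ^ 2)
        + ∑ i ∈ Finset.Icc 1 (T - 1),
            (hybridNoise p n M sim dis T σ - hybridNoise p n M sim dis i σ)) ∧
    generalizationError μ T wstar (randomHybridWeights n M sim dis wstar x z) =
      1 / (T : ℝ) *
        (hybridD0 p n M sim dis T * (∑ i ∈ Finset.Icc 1 T, ‖wstar i‖ ^ 2)
        + ∑ i ∈ Finset.Icc 1 T, ∑ j ∈ Finset.Icc 1 T, ∑ k ∈ Finset.Icc 1 T,
            hybridD p n M sim dis i j k T * ‖wstar j - wstar k‖ ^ 2)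
      + hybridNoise p n M sim dis T σ := by
  have hbound : ∀ t, 1 ≤ t → t ≤ T → ∀ h ∈ sim t ∪ (dis t).toFinset, 1 ≤ h ∧ h < t :=
    fun t h1 hT h hh => by
      rw [hcover t h1 hT, Finset.mem_Icc] at hh
      omega
  have hsim : ∀ t, 1 ≤ t → t ≤ T → ∀ h ∈ sim t, 1 ≤ h ∧ h < t := fun t h1 hT h hh =>
    hbound t h1 hT h (Finset.mem_union_left _ hh)
  have hdis : ∀ t, 1 ≤ t → t ≤ T → ∀ h ∈ dis t, 1 ≤ h ∧ h < t := fun t h1 hT h hh =>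
    hbound t h1 hT h (Finset.mem_union_right _ (List.mem_toFinset.2 hh))
  have hsim1 : sim 1 = ∅ := Finset.eq_empty_of_forall_notMem fun h hh => by
    have := hsim 1 le_rfl (by omega) h hh
    omega
  have hdis1 : dis 1 = [] := List.eq_nil_iff_forall_not_mem.2 fun h hh => by
    have := hdis 1 le_rfl (by omega) h hh
    omega
  obtain ⟨ξ, hξ, hx⟩ := hdata.exists_indepSamples
  have herr : ∀ t, t ≤ T → HasExpectedError μ ξ {s | s ∈ validIndex T n M ∧ s.1 ≤ t}
      (randomHybridWeights n M sim dis wstar x z t) (expectedError p n M σ sim dis wstar t) :=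
    fun t ht => hasExpectedError_randomHybridWeights hn hnodup hdisj hsim hdis hp hden wstar hξ hx ht
  have hint : ∀ i t, t ≤ T → MeasureTheory.Integrable
      (fun ω => modelError wstar i (randomHybridWeights n M sim dis wstar x z t ω)) μ :=
    fun i t ht => (herr t ht).integrable (wstar i)
  -- The coefficients d_{ijkt} are meaningful only for i ≤ t; forgetting uses the formula at t = T
  -- and at t = i, the generalization error only at t = T.
  have hval : ∀ i t, 1 ≤ i → i ≤ t → t ≤ T →
      ∫ ω, modelError wstar i (randomHybridWeights n M sim dis wstar x z t ω) ∂μ =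
        hybridD0 p n M sim dis t * ‖wstar i‖ ^ 2
        + (∑ j ∈ Finset.Icc 1 T, ∑ k ∈ Finset.Icc 1 T,
            hybridD p n M sim dis i j k t * ‖wstar j - wstar k‖ ^ 2)
        + hybridNoise p n M sim dis t σ := by
    intro i t hi hit ht
    refine ((herr t ht).integral_eq (wstar i)).trans ?_
    rw [expectedError_eq (by omega) hdvd hsim1 hdis1 σ wstar (by omega) ht,
      sum_taskIncrement hsim hdis hsim1 hdis1 σ wstar (by omega) ht,
      sum_hybridD_mul hsim hdis hi hit ht (δ := fun j k => ‖wstar j - wstar k‖ ^ 2)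
        (fun j k => by rw [norm_sub_rev]) fun j => by simp]
    ring
  refine ⟨fun i t _ _ _ ht => hint i t ht, ?_, ?_⟩
  · rw [forgetting, ← Finset.sum_add_distrib, ← Finset.sum_add_distrib]
    congr 1
    refine Finset.sum_congr rfl fun i hi => ?_
    rw [Finset.mem_Icc] at hi
    rw [integral_sub (hint i T le_rfl) (hint i i (by omega)), hval i T hi.1 (by omega) le_rfl,
      hval i i hi.1 le_rfl (by omega), hybridC0]
    simp only [hybridC, sub_mul, Finset.sum_sub_distrib]
    ring
  · have hT0 : (T : ℝ) ≠ 0 := by positivity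
    have hsum : ∑ i ∈ Finset.Icc 1 T,
        ∫ ω, modelError wstar i (randomHybridWeights n M sim dis wstar x z T ω) ∂μ =
        ∑ i ∈ Finset.Icc 1 T, (hybridD0 p n M sim dis T * ‖wstar i‖ ^ 2
        + (∑ j ∈ Finset.Icc 1 T, ∑ k ∈ Finset.Icc 1 T,
            hybridD p n M sim dis i j k T * ‖wstar j - wstar k‖ ^ 2)
        + hybridNoise p n M sim dis T σ) := Finset.sum_congr rfl fun i hi => by
      rw [Finset.mem_Icc] at hi
      exact hval i T hi.1 hi.2 le_rfl
    rw [generalizationError, hsum, Finset.sum_add_distrib, Finset.sum_add_distrib, ← Finset.mul_sum,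
      Finset.sum_const, Nat.card_Icc, Nat.add_sub_cancel, nsmul_eq_mul]
    field_simp
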